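/- For each $p\in\mathbb N$ let $k=k(p)\in\mathbb N$, $\sigma=\sigma(p)>0$, $n=n(p)\in\mathbb N$, and let $(b_1,\dots,b_k)\in\mathbb R^k$ be a fixed vector depending on $p$; put $b_{\min}=\min_i|b_i|$ and $b_{\max}=\max_i|b_i|$. Let the support $S$ be uniform on the $k$-element subsets of $\{1,\dots,p\}$; let $\beta\in\mathbb R^p$ be zero off $S$, its entries on $S$ being a uniformly random permutation of $(b_1,\dots,b_k)$; let $\mathbf X\in\mathbb R^{n\times p}$ have i.i.d. $N(0,1)$ entries and rows $X^{(1)},\dots,X^{(n)}$; and let $Z_1,\dots,Z_n$ be i.i.d. $N(0,\sigma^2)$, where $S$, the permutation, $\mathbf X$ and the noise are independent. In the 1-bit model the observations are $Y^{(i)}=\operatorname{sign}(\langle X^{(i)},\beta\rangle+Z_i)$, $i=1,\dots,n$, where $\operatorname{sign}(t)=1$ for $t\ge 0$ and $\operatorname{sign}(t)=-1$ for $t<0$; in the linear model they are $Y^{(i)}=\langle X^{(i)},\beta\rangle+Z_i$. A decoder is a deterministic measurable map $(\mathbf X,\mathbf Y)\mapsto\hat S$, which may depend on $p,k,n,\sigma$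 and $(b_1,\dots,b_k)$; its error probability is $P_e=\mathbb P[\hat S\ne S]$. Assume that, as $p\to\infty$, $k=\Theta(1)$, $\sigma^2=\Theta(1)$, $b_{\min}=\Theta(b_{\max})$ and $b_{\min}=o(1)$, with $b_{\min}>0$ for all large $p$. Let $$n^*=n^*(p)=\max_{\emptyset\ne s_{\mathrm{dif}}\subseteq\{1,\dots,k\}}\frac{|s_{\mathrm{dif}}|\log p}{\frac1{\pi\sigma^2}\sum_{i\in s_{\mathrm{dif}}}b_i^2}$$ and let $\eta>0$ be a constant not depending on $p$. Then, for the 1-bit model: (i) if $n\ge n^*(1+\eta)$ for all large $p$, there is a sequence of decoders with $P_e\to0$ as $p\to\infty$; (ii) if $n\le n^*(1-\eta)$ for all large $p$, then $P_e\to1$ as $p\to\infty$ for every sequence of decoders. Moreover, quantization increases the asymptotically required number of measurements only by the factor $\pi/2$: for the linear model under the same assumptions, (i) and (ii) hold with $n^*$ replaced by $n^*/(\pi/2)$. -/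

import Mathlib

open Filter Topology Asymptotics MeasureTheory ProbabilityTheory

noncomputable section

namespace SupportRecovery

/-- The quantizer of the 1-bit model: `1` on non-negative reals and `-1` on negative reals. -/
def sgn (t : ℝ) : ℝ := if 0 ≤ t then 1 else -1

/-- Smallest absolute value of the entries of `b`. -/
def bMin {k : ℕ} (b : Fin k → ℝ) : ℝ := ⨅ i, |b i|

/-- Largest absolute value of the entries of `b`. -/
def bMax {k : ℕ} (b : Fin k → ℝ) : ℝ := ⨆ i, |b i|

/-- The possible supports: the subsets of the `p` coordinates that have exactly `k` elements. -/
abbrev Support (p k : ℕ) : Type := {S : Finset (Fin p) // S.card = k}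

/-- The vector `β ∈ ℝ^p` that vanishes off `S` and whose entries on `S`, in increasing order of
the coordinates, are the entries of `b` permuted by `τ`. -/
def signal {p k : ℕ} (b : Fin k → ℝ) (S : Support p k) (τ : Equiv.Perm (Fin k)) : Fin p → ℝ :=
  Function.extend (S.1.orderEmbOfFin S.2) (fun i => b (τ i)) 0

/-- The `n` observations `g (⟨X⁽ⁱ⁾, β⟩ + Zᵢ)`. The linear model is `g = id`, the 1-bit model
is `g = sgn`. -/
def observe {p n : ℕ} (g : ℝ → ℝ) (β : Fin p → ℝ) (X : Fin n → Fin p → ℝ) (Z : Fin n → ℝ) :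
    Fin n → ℝ :=
  fun i => g ((∑ j, X i j * β j) + Z i)

/-- The joint law of the measurement matrix, with i.i.d. `N(0,1)` entries, and of the independent
noise vector, with i.i.d. `N(0,σ²)` entries. -/
def designNoise (p n : ℕ) (σ : ℝ) : Measure ((Fin n → Fin p → ℝ) × (Fin n → ℝ)) :=
  (Measure.pi fun _ : Fin n => Measure.pi fun _ : Fin p => gaussianReal 0 1).prod
    (Measure.pi fun _ : Fin n => gaussianReal 0 (Real.toNNReal (σ ^ 2)))

/-- A deterministic (measurable) decoder: it estimates the support from the measurement matrix
and the observations. -/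
structure Decoder (p n : ℕ) where
  /-- The estimate of the support. -/
  est : (Fin n → Fin p → ℝ) → (Fin n → ℝ) → Finset (Fin p)
  measurableSet_est : ∀ T : Finset (Fin p),
    MeasurableSet {q : (Fin n → Fin p → ℝ) × (Fin n → ℝ) | est q.1 q.2 = T}

/-- The error probability `P[Ŝ ≠ S]`, where `S` is uniform on the `k`-subsets of the coordinates,
the non-zero entries of `β` are a uniformly random permutation of `b`, and `S`, the permutation,
the measurement matrix and the noise are independent. -/
def errorProb {p k n : ℕ} (g : ℝ → ℝ) (σ : ℝ) (b : Fin k → ℝ) (dec : Decoder p n) : ℝ :=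
  (∑ S : Support p k, ∑ τ : Equiv.Perm (Fin k),
    (designNoise p n σ).real
      {ω | dec.est ω.1 (observe g (signal b S τ) ω.1 ω.2) ≠ S.1}) /
    ((p.choose k : ℝ) * (k.factorial : ℝ))

/-- `max_{s ≠ ∅} |s| log p / ((1/(π σ²)) ∑_{i ∈ s} bᵢ²)`, over the non-empty subsets `s` of the
index set of `b`. -/
def oneBitThreshold {k : ℕ} (p : ℕ) (σ : ℝ) (b : Fin k → ℝ) : ℝ :=
  ⨆ s : {s : Finset (Fin k) // s.Nonempty},
    ((s.1.card : ℝ) * Real.log p) / (1 / (Real.pi * σ ^ 2) * ∑ i ∈ s.1, b i ^ 2)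

end SupportRecovery

end

noncomputable section

namespace SupportRecovery

open scoped ENNReal NNReal

/-! The ratio `|s| / ∑ b i ^ 2` is largest at the singleton of a smallest entry, so n* = πσ² log p /
b_min² (`oneBitThreshold_eq`). In words, the bottleneck is locating one weakest entry among about p
columns. As b → 0, one sign observation carries about b²/(πσ²) nats about it and one linear
observation about b²/(2σ²), hence the factor π/2.

Achievability uses correlation thresholding: keep the columns with |∑ X_ij Y_i| > t, where t is a
fraction θ < 1 of the smallest mean correlation of a relevant column. A column off the support is
independent of the observations, so a Chernoff bound and a union over p columns control false
alarms. A relevant column has mean correlation at least n·b_min·√(2/(πV)) in absolute value (1-bit)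
or n·b_min (linear), where V = σ² + ∑ b_i². There are boundedly many such columns, so Chebyshev
suffices for misses (`errorProb_thresholdDecoder_le`). Since V/σ² → 1, the other entries act as
negligible extra noise and the exponent beats log p exactly above the threshold.

The converse compares the true law with a reference law that knows all positions except that of the
weakest entry `i₀` and ignores its column. Under the reference law a decoder succeeds with average
probability at most 1/(p-k+1), because the candidate answers are disjoint events
(`sum_restPositions_le`). The change of measure P(A) ≤ c Q(A) + c^(-ρ) E_P[(dP/dQ)^ρ] with c
slightly below p transfers this to the true law, provided the moment of order 1+ρ grows slower than
p^ρ (`one_sub_errorProb_le`). The moment is an explicit Gaussian integral for the linear channel.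
For the sign channel it comes from a second-order expansion around the fair coin
(`lintegral_signDensity_rpow_le`). -/

/-! ### One measurement -/

/-- The law of one row of the measurement matrix together with the noise of that row. -/
def rowLaw (p : ℕ) (σ : ℝ) : Measure ((Fin p → ℝ) × ℝ) :=
  (Measure.pi fun _ : Fin p => gaussianReal 0 1).prod (gaussianReal 0 (Real.toNNReal (σ ^ 2)))

instance (p : ℕ) (σ : ℝ) : IsProbabilityMeasure (rowLaw p σ) := by
  unfold rowLaw; infer_instance

/-- One observation together with its row. -/
def rowObs {p : ℕ} (g : ℝ → ℝ) (β : Fin p → ℝ) (ω : (Fin p → ℝ) × ℝ) : (Fin p → ℝ) × ℝ :=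
  (ω.1, g ((∑ j, ω.1 j * β j) + ω.2))

lemma measurable_rowObs {p : ℕ} {g : ℝ → ℝ} (hg : Measurable g) (β : Fin p → ℝ) :
    Measurable (rowObs g β) := by
  unfold rowObs
  fun_prop

lemma measurable_sgn : Measurable sgn := by
  unfold sgn
  exact Measurable.ite measurableSet_Ici measurable_const measurable_const

lemma measurable_observe {p n : ℕ} {g : ℝ → ℝ} (hg : Measurable g) (β : Fin p → ℝ) :
    Measurable fun ω : (Fin n → Fin p → ℝ) × (Fin n → ℝ) => (ω.1, observe g β ω.1 ω.2) := by
  unfold observe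
  fun_prop

lemma Decoder.measurableSet_ne {p n : ℕ} (dec : Decoder p n) (T : Finset (Fin p)) :
    MeasurableSet {q : (Fin n → Fin p → ℝ) × (Fin n → ℝ) | dec.est q.1 q.2 ≠ T} :=
  (dec.measurableSet_est T).compl

/-- The set of unpaired samples on which the decoder returns `T`. -/
def Decoder.region {p n : ℕ} (dec : Decoder p n) (T : Finset (Fin p)) :
    Set (Fin n → (Fin p → ℝ) × ℝ) :=
  {q | dec.est (fun i => (q i).1) (fun i => (q i).2) = T}

lemma Decoder.measurableSet_region {p n : ℕ} (dec : Decoder p n) (T : Finset (Fin p)) :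
    MeasurableSet (dec.region T) := by
  have : Measurable fun q : Fin n → (Fin p → ℝ) × ℝ =>
      ((fun i => (q i).1, fun i => (q i).2) : (Fin n → Fin p → ℝ) × (Fin n → ℝ)) := by fun_prop
  exact this (dec.measurableSet_est T)

lemma designNoise_eq_map (p n : ℕ) (σ : ℝ) :
    designNoise p n σ = (Measure.pi fun _ : Fin n => rowLaw p σ).map
      fun q => (fun i => (q i).1, fun i => (q i).2) :=
  (measurePreserving_arrowProdEquivProdArrow (Fin p → ℝ) ℝ (Fin n)
    (fun _ => Measure.pi fun _ : Fin p => gaussianReal 0 1)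
    (fun _ => gaussianReal 0 (Real.toNNReal (σ ^ 2)))).map_eq.symm

instance (p n : ℕ) (σ : ℝ) : IsProbabilityMeasure (designNoise p n σ) := by
  unfold designNoise; infer_instance

lemma designNoise_apply {p n : ℕ} (σ : ℝ) {A : Set ((Fin n → Fin p → ℝ) × (Fin n → ℝ))}
    (hA : MeasurableSet A) :
    designNoise p n σ A =
      (Measure.pi fun _ : Fin n => rowLaw p σ) {q | (fun i => (q i).1, fun i => (q i).2) ∈ A} := by
  rw [designNoise_eq_map, Measure.map_apply (by fun_prop) hA]
  rfl

/-- Regrouping the matrix and the noise row by row turns the sample into n i.i.d. pairs (row,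
observation), so that all later estimates are about product measures. -/
lemma designNoise_decode {p n : ℕ} {g : ℝ → ℝ} (hg : Measurable g) (σ : ℝ) (β : Fin p → ℝ)
    (dec : Decoder p n) (T : Finset (Fin p)) :
    designNoise p n σ {ω | dec.est ω.1 (observe g β ω.1 ω.2) = T} =
      (Measure.pi fun _ : Fin n => (rowLaw p σ).map (rowObs g β)) (dec.region T) := by
  have : IsProbabilityMeasure ((rowLaw p σ).map (rowObs g β)) :=
    Measure.isProbabilityMeasure_map (measurable_rowObs hg β).aemeasurable
  rw [← Measure.pi_map_pi (fun _ => (measurable_rowObs hg β).aemeasurable),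
    Measure.map_apply _ (dec.measurableSet_region T), designNoise_apply]
  · rfl
  · exact measurable_observe hg β (dec.measurableSet_est T)
  · have := measurable_rowObs hg β
    fun_prop

/-! ### Supports and permutations as embeddings -/

/-- The signal that has the entry `b i` at the coordinate `e i`. -/
def embSignal {ι : Type*} {p : ℕ} (b : ι → ℝ) (e : ι ↪ Fin p) : Fin p → ℝ :=
  Function.extend e b 0

lemma sum_mul_embSignal {ι : Type*} [Fintype ι] {p : ℕ} (b : ι → ℝ) (e : ι ↪ Fin p)
    (x : Fin p → ℝ) : ∑ j, x j * embSignal b e j = ∑ i, x (e i) * b i := by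
  classical
  have h0 : ∀ j ∉ Finset.univ.map e, x j * embSignal b e j = 0 := by
    intro j hj
    have : ¬ ∃ i, e i = j := by simpa using hj
    simp [embSignal, Function.extend_apply' _ _ _ this]
  rw [← Finset.sum_subset (Finset.subset_univ (Finset.univ.map e)) fun j _ hj => h0 j hj,
    Finset.sum_map]
  simp [embSignal, e.injective.extend_apply]

/-- The position of each entry of `b` for the support `S` and the permutation `τ`. -/
def positions {p k : ℕ} (x : Support p k × Equiv.Perm (Fin k)) : Fin k ↪ Fin p :=
  -- `signal` puts `b (τ i)` on the `i`-th point of the support, so the entry `i` sits on the point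
  -- with number `τ⁻¹ i`.
  x.2.symm.toEmbedding.trans (x.1.1.orderEmbOfFin x.1.2).toEmbedding

lemma map_positions {p k : ℕ} (x : Support p k × Equiv.Perm (Fin k)) :
    Finset.univ.map (positions x) = x.1.1 := by
  ext j
  have := Finset.range_orderEmbOfFin x.1.1 x.1.2
  rw [← Finset.mem_coe (s := x.1.1), ← this]
  simp only [positions, Finset.mem_map, Finset.mem_univ, true_and, Set.mem_range]
  exact ⟨fun ⟨i, hi⟩ => ⟨_, hi⟩, fun ⟨i, hi⟩ => ⟨x.2 i, by simpa using hi⟩⟩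

lemma signal_eq_embSignal {p k : ℕ} (b : Fin k → ℝ) (x : Support p k × Equiv.Perm (Fin k)) :
    signal b x.1 x.2 = embSignal b (positions x) := by
  ext j
  by_cases h : ∃ i, x.1.1.orderEmbOfFin x.1.2 i = j
  · obtain ⟨i, rfl⟩ := h
    have : x.1.1.orderEmbOfFin x.1.2 i = positions x (x.2 i) := by simp [positions]
    rw [signal, (x.1.1.orderEmbOfFin x.1.2).injective.extend_apply, this, embSignal,
      (positions x).injective.extend_apply]
  · have h' : ¬ ∃ i, positions x i = j := by
      rintro ⟨i, rfl⟩
      exact h ⟨_, rfl⟩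
    rw [signal, embSignal, Function.extend_apply' _ _ _ h, Function.extend_apply' _ _ _ h']

/-- A uniform support with a uniform permutation is a uniform embedding of the entries into the
columns. In this form a single entry can be singled out and its position forgotten. -/
lemma bijective_positions (p k : ℕ) :
    Function.Bijective (positions : Support p k × Equiv.Perm (Fin k) → (Fin k ↪ Fin p)) := by
  rw [Fintype.bijective_iff_injective_and_card]
  refine ⟨?_, ?_⟩
  · rintro ⟨S, τ⟩ ⟨S', τ'⟩ h
    have hS : S = S' := by
      apply Subtype.ext
      rw [← map_positions (S, τ), ← map_positions (S', τ'), h]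
    subst hS
    simp only [Prod.mk.injEq, true_and]
    rw [← Equiv.symm_bijective.injective.eq_iff]
    ext i : 1
    exact (S.1.orderEmbOfFin S.2).injective (DFunLike.congr_fun h i)
  · rw [Fintype.card_prod, Fintype.card_perm, Fintype.card_embedding_eq, Fintype.card_fin,
      Fintype.card_fin, Nat.descFactorial_eq_factorial_mul_choose, mul_comm]
    simp

lemma descFactorial_eq (p k : ℕ) :
    (p.choose k : ℝ) * (k.factorial : ℝ) = (p.descFactorial k : ℝ) := by
  rw [Nat.descFactorial_eq_factorial_mul_choose, mul_comm]
  push_cast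
  rfl

lemma errorProb_eq_sum_embedding {p k n : ℕ} (g : ℝ → ℝ) (σ : ℝ) (b : Fin k → ℝ)
    (dec : Decoder p n) :
    errorProb g σ b dec = (∑ e : Fin k ↪ Fin p, (designNoise p n σ).real
      {ω | dec.est ω.1 (observe g (embSignal b e) ω.1 ω.2) ≠ Finset.univ.map e}) /
      (p.descFactorial k : ℝ) := by
  rw [errorProb, descFactorial_eq, ← Fintype.sum_prod_type' (f := fun S τ =>
    (designNoise p n σ).real {ω | dec.est ω.1 (observe g (signal b S τ) ω.1 ω.2) ≠ S.1})]
  congr 1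
  refine Fintype.sum_bijective _ (bijective_positions p k) _ _ fun x => ?_
  rw [signal_eq_embSignal, map_positions]

lemma errorProb_nonneg {p k n : ℕ} (g : ℝ → ℝ) (σ : ℝ) (b : Fin k → ℝ) (dec : Decoder p n) :
    0 ≤ errorProb g σ b dec := by
  unfold errorProb
  positivity

lemma errorProb_le_of_forall {p k n : ℕ} (g : ℝ → ℝ) (σ : ℝ) (b : Fin k → ℝ) (dec : Decoder p n)
    {c : ℝ} (hc : 0 ≤ c) (h : ∀ e : Fin k ↪ Fin p, (designNoise p n σ).real
      {ω | dec.est ω.1 (observe g (embSignal b e) ω.1 ω.2) ≠ Finset.univ.map e} ≤ c) :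
    errorProb g σ b dec ≤ c := by
  rw [errorProb_eq_sum_embedding]
  -- For `k > p` there is no embedding and the quotient is 0/0 = 0; this is where `0 ≤ c` is needed.
  refine div_le_of_le_mul₀ (by positivity) hc ?_
  refine (Finset.sum_le_sum fun e _ => h e).trans ?_
  simp [Fintype.card_embedding_eq, mul_comm]

lemma errorProb_le_one {p k n : ℕ} (g : ℝ → ℝ) (σ : ℝ) (b : Fin k → ℝ) (dec : Decoder p n) :
    errorProb g σ b dec ≤ 1 :=
  errorProb_le_of_forall g σ b dec zero_le_one fun _ => measureReal_le_one

lemma one_sub_errorProb {p k n : ℕ} (hkp : k ≤ p) {g : ℝ → ℝ} (hg : Measurable g) (σ : ℝ)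
    (b : Fin k → ℝ) (dec : Decoder p n) :
    1 - errorProb g σ b dec = (∑ e : Fin k ↪ Fin p,
      (Measure.pi fun _ : Fin n => (rowLaw p σ).map (rowObs g (embSignal b e))).real
        (dec.region (Finset.univ.map e))) / (p.descFactorial k : ℝ) := by
  have hpos : (0 : ℝ) < p.descFactorial k := by
    exact_mod_cast Nat.descFactorial_pos.2 hkp
  rw [errorProb_eq_sum_embedding, eq_div_iff hpos.ne', sub_mul, div_mul_cancel₀ _ hpos.ne', one_mul]
  have hcard : (p.descFactorial k : ℝ) = ∑ _e : Fin k ↪ Fin p, (1 : ℝ) := by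
    simp [Fintype.card_embedding_eq]
  rw [hcard, ← Finset.sum_sub_distrib]
  refine Finset.sum_congr rfl fun e _ => ?_
  have hm := measurable_observe (n := n) hg (embSignal b e) (dec.measurableSet_est (Finset.univ.map e))
  have h := probReal_compl_eq_one_sub (μ := designNoise p n σ) hm
  rw [measureReal_def (μ := Measure.pi _), ← designNoise_decode hg, ← measureReal_def]
  exact sub_eq_iff_eq_add.2 (sub_eq_iff_eq_add'.1 (h.symm.trans rfl))

/-! ### Change of measure for product laws -/

lemma lintegral_pi_prod {Ω : Type*} [MeasurableSpace Ω] {n : ℕ} (m : Measure Ω)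
    [IsProbabilityMeasure m] {F : Fin n → Ω → ℝ≥0∞} (hF : ∀ i, Measurable (F i)) :
    ∫⁻ ω, ∏ i, F i (ω i) ∂(Measure.pi fun _ : Fin n => m) = ∏ i, ∫⁻ x, F i x ∂m := by
  have hind := iIndepFun_pi (μ := fun _ : Fin n => m) (X := F) fun i => (hF i).aemeasurable
  refine (lintegral_prod_eq_prod_lintegral_of_indepFun Finset.univ (fun (i : Fin n) (ω : Fin n → Ω) => F i (ω i)) hind
    fun i => (hF i).comp (measurable_pi_apply i)).trans ?_
  refine Finset.prod_congr rfl fun i _ => ?_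
  have := (measurePreserving_eval (fun _ : Fin n => m) i).lintegral_comp (hF i)
  simpa using this

/-- Checked on boxes, where the indicator of the box times the product density is again a product of
functions of one coordinate. -/
lemma pi_withDensity {Ω : Type*} [MeasurableSpace Ω] {n : ℕ} (m : Measure Ω)
    [IsProbabilityMeasure m] {P : Ω → ℝ≥0∞} (hP : Measurable P) [SigmaFinite (m.withDensity P)] :
    (Measure.pi fun _ : Fin n => m.withDensity P) =
      (Measure.pi fun _ : Fin n => m).withDensity fun ω => ∏ i, P (ω i) := by
  refine Measure.pi_eq fun s hs => ?_
  rw [withDensity_apply _ (MeasurableSet.univ_pi hs),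
    ← lintegral_indicator (MeasurableSet.univ_pi hs)]
  have : ∀ ω : Fin n → Ω, (Set.univ.pi s).indicator (fun ω => ∏ i, P (ω i)) ω =
      ∏ i, (s i).indicator P (ω i) := by
    intro ω
    by_cases h : ∀ i, ω i ∈ s i
    · rw [Set.indicator_of_mem (by simpa using h)]
      exact Finset.prod_congr rfl fun i _ => (Set.indicator_of_mem (h i) P).symm
    · rw [Set.indicator_of_notMem (by simpa using h)]
      obtain ⟨i, hi⟩ := not_forall.1 h
      exact (Finset.prod_eq_zero (Finset.mem_univ i) (Set.indicator_of_notMem hi P)).symm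
  simp_rw [this]
  rw [lintegral_pi_prod m fun i => hP.indicator (hs i)]
  refine Finset.prod_congr rfl fun i _ => ?_
  rw [lintegral_indicator (hs i), withDensity_apply _ (hs i)]

/-- Either `x ≤ c * y`, or the ratio `x / (c * y)` exceeds 1 and so does its power `ρ`. Applied to
densities, this is the pointwise form of the change of measure. -/
lemma le_mul_add_rpow {x y c ρ : ℝ} (hx : 0 ≤ x) (hy : 0 < y) (hc : 0 < c) (hρ : 0 < ρ) :
    x ≤ c * y + c ^ (-ρ) * (x ^ (1 + ρ) * y ^ (-ρ)) := by
  rcases le_or_gt x (c * y) with h | h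
  · have : 0 ≤ c ^ (-ρ) * (x ^ (1 + ρ) * y ^ (-ρ)) := by positivity
    linarith
  · have hx' : 0 < x := (mul_pos hc hy).trans h
    have h1 : 1 ≤ (x / (c * y)) ^ ρ :=
      Real.one_le_rpow ((one_le_div (mul_pos hc hy)).2 h.le) hρ.le
    have h2 : c ^ (-ρ) * (x ^ (1 + ρ) * y ^ (-ρ)) = x * (x / (c * y)) ^ ρ := by
      rw [Real.div_rpow hx (mul_pos hc hy).le, Real.mul_rpow hc.le hy.le, Real.rpow_add hx',
        Real.rpow_one, Real.rpow_neg hc.le, Real.rpow_neg hy.le]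
      field_simp
    rw [h2]
    have : x * 1 ≤ x * (x / (c * y)) ^ ρ := by gcongr
    have : 0 < c * y := mul_pos hc hy
    linarith

/-- Comparison of the product laws with densities `P` and `Q`, in terms of the moment of order
`1 + ρ` of the likelihood ratio. -/
lemma pi_withDensity_le {Ω : Type*} [MeasurableSpace Ω] {n : ℕ} (m : Measure Ω)
    [IsProbabilityMeasure m] {P Q : Ω → ℝ} (hPm : Measurable P) (hQm : Measurable Q)
    (hP : ∀ x, 0 ≤ P x) (hQ : ∀ x, 0 < Q x)
    [SigmaFinite (m.withDensity fun x => ENNReal.ofReal (P x))]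
    [SigmaFinite (m.withDensity fun x => ENNReal.ofReal (Q x))]
    {c ρ : ℝ} (hc : 0 < c) (hρ : 0 < ρ) {A : Set (Fin n → Ω)} (hA : MeasurableSet A) :
    (Measure.pi fun _ : Fin n => m.withDensity fun x => ENNReal.ofReal (P x)) A ≤
      ENNReal.ofReal c * (Measure.pi fun _ : Fin n => m.withDensity fun x => ENNReal.ofReal (Q x)) A
      + ENNReal.ofReal (c ^ (-ρ)) *
        (∫⁻ x, ENNReal.ofReal (P x ^ (1 + ρ) * Q x ^ (-ρ)) ∂m) ^ n := by
  have hPQ : Measurable fun x => ENNReal.ofReal (P x ^ (1 + ρ) * Q x ^ (-ρ)) := by fun_prop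
  rw [pi_withDensity m hPm.ennreal_ofReal, pi_withDensity m hQm.ennreal_ofReal,
    withDensity_apply _ hA, withDensity_apply _ hA]
  have hprod : (∫⁻ x, ENNReal.ofReal (P x ^ (1 + ρ) * Q x ^ (-ρ)) ∂m) ^ n =
      ∫⁻ ω, ∏ i, ENNReal.ofReal (P (ω i) ^ (1 + ρ) * Q (ω i) ^ (-ρ))
        ∂(Measure.pi fun _ : Fin n => m) := by
    rw [lintegral_pi_prod m fun _ : Fin n => hPQ]
    simp
  rw [hprod, ← lintegral_const_mul _ (by fun_prop), ← lintegral_const_mul _ (by fun_prop)]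
  -- The moment term is taken over the whole space, where it factorizes.
  refine le_trans ?_ (add_le_add_right (setLIntegral_le_lintegral A _) _)
  rw [← lintegral_add_left (by fun_prop)]
  refine lintegral_mono fun ω => ?_
  have hQ' : 0 < ∏ i, Q (ω i) := Finset.prod_pos fun i _ => hQ _
  have hP' : 0 ≤ ∏ i, P (ω i) := Finset.prod_nonneg fun i _ => hP _
  rw [← ENNReal.ofReal_prod_of_nonneg fun i _ => hP _,
    ← ENNReal.ofReal_prod_of_nonneg fun i _ => (hQ _).le,
    ← ENNReal.ofReal_prod_of_nonneg fun i _ => mul_nonneg (Real.rpow_nonneg (hP _) _)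
      (Real.rpow_nonneg (hQ _).le _), ← ENNReal.ofReal_mul hc.le,
    ← ENNReal.ofReal_mul (Real.rpow_nonneg hc.le _),
    ← ENNReal.ofReal_add (by positivity) (mul_nonneg (Real.rpow_nonneg hc.le _)
      (Finset.prod_nonneg fun i _ => mul_nonneg (Real.rpow_nonneg (hP _) _)
      (Real.rpow_nonneg (hQ _).le _)))]
  refine ENNReal.ofReal_le_ofReal ?_
  rw [Finset.prod_mul_distrib, Real.finsetProd_rpow _ _ fun i _ => hP _,
    Real.finsetProd_rpow _ _ fun i _ => (hQ _).le]
  exact le_mul_add_rpow hP' hQ' hc hρ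

/-! ### Converse bound -/

/-- `f t` is a positive density with respect to `ν` of the observation `g (t + Z)`. -/
structure IsChannelDensity (g : ℝ → ℝ) (σ : ℝ) (ν : Measure ℝ) (f : ℝ → ℝ → ℝ) : Prop where
  measurable : Measurable f.uncurry
  pos : ∀ t y, 0 < f t y
  map_eq : ∀ t, (gaussianReal 0 (Real.toNNReal (σ ^ 2))).map (fun z => g (t + z)) =
    ν.withDensity fun y => ENNReal.ofReal (f t y)

lemma map_rowObs_eq_withDensity {p : ℕ} {g : ℝ → ℝ} (hg : Measurable g) {σ : ℝ} {ν : Measure ℝ}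
    [IsProbabilityMeasure ν] {f : ℝ → ℝ → ℝ} (hf : IsChannelDensity g σ ν f) (β : Fin p → ℝ) :
    (rowLaw p σ).map (rowObs g β) =
      ((Measure.pi fun _ : Fin p => gaussianReal 0 1).prod ν).withDensity
        fun ω => ENNReal.ofReal (f (∑ j, ω.1 j * β j) ω.2) := by
  have hfm := hf.measurable
  have hm : Measurable fun ω : (Fin p → ℝ) × ℝ =>
      ENNReal.ofReal (f (∑ j, ω.1 j * β j) ω.2) :=
    (hfm.comp (f := fun ω : (Fin p → ℝ) × ℝ => (∑ j, ω.1 j * β j, ω.2))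
      (by fun_prop)).ennreal_ofReal
  ext A hA
  rw [Measure.map_apply (measurable_rowObs hg β) hA, rowLaw,
    Measure.prod_apply (measurable_rowObs hg β hA), withDensity_apply _ hA,
    ← lintegral_indicator hA, lintegral_prod _ (hm.indicator hA).aemeasurable]
  refine lintegral_congr fun x => ?_
  have hx : MeasurableSet (Prod.mk x ⁻¹' A) := measurable_prodMk_left hA
  have h := congrArg (fun μ : Measure ℝ => μ (Prod.mk x ⁻¹' A)) (hf.map_eq (∑ j, x j * β j))
  rw [Measure.map_apply (by fun_prop) hx, withDensity_apply _ hx, ← lintegral_indicator hx] at h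
  exact h

/-- The positions of all entries except the one with index `i₀`. -/
def restPositions {p k : ℕ} (i₀ : Fin k) (e : Fin k ↪ Fin p) : {i : Fin k // i ≠ i₀} ↪ Fin p :=
  (Function.Embedding.subtype _).trans e

/-- The position of `i₀` is the only point of the support not occupied by the other entries. -/
lemma eq_of_restPositions_eq {p k : ℕ} {i₀ : Fin k} {e e' : Fin k ↪ Fin p}
    (h : restPositions i₀ e = restPositions i₀ e')
    (hmap : Finset.univ.map e = Finset.univ.map e') : e = e' := by
  have hne : ∀ i, i ≠ i₀ → e i = e' i := fun i hi => DFunLike.congr_fun h ⟨i, hi⟩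
  have h0 : e i₀ ∈ Finset.univ.map e' := hmap ▸ Finset.mem_map_of_mem e (Finset.mem_univ i₀)
  obtain ⟨i, -, hi⟩ := Finset.mem_map.1 h0
  have hi0 : i = i₀ := by
    by_contra hcon
    rw [← hne i hcon] at hi
    exact hcon (e.injective hi)
  ext1 l
  by_cases hl : l = i₀
  · rw [hl, ← hi, hi0]
  · exact hne l hl

/-- Once the other positions are fixed, the reference law is fixed and distinct positions of `i₀`
give distinct supports, hence disjoint decoding regions of total mass at most 1. There are
`p.descFactorial (k - 1)` ways to fix the other positions. -/
lemma sum_restPositions_le {p k n : ℕ} (i₀ : Fin k) (dec : Decoder p n)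
    (Q : ({i : Fin k // i ≠ i₀} ↪ Fin p) → Measure (Fin n → (Fin p → ℝ) × ℝ))
    [∀ r, IsProbabilityMeasure (Q r)] :
    ∑ e : Fin k ↪ Fin p, (Q (restPositions i₀ e)).real (dec.region (Finset.univ.map e)) ≤
      p.descFactorial (k - 1) := by
  classical
  rw [← Finset.sum_fiberwise Finset.univ (restPositions i₀)]
  calc _ ≤ ∑ _r : {i : Fin k // i ≠ i₀} ↪ Fin p, (1 : ℝ) := by
        refine Finset.sum_le_sum fun r _ => ?_
        rw [Finset.sum_congr rfl fun e he => by rw [(Finset.mem_filter.1 he).2]]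
        rw [← measureReal_biUnion_finset]
        · exact measureReal_le_one
        · intro e he e' he' hne
          refine Set.disjoint_left.2 fun q hq hq' => hne ?_
          refine eq_of_restPositions_eq (i₀ := i₀) ?_ (Eq.trans (Eq.symm hq) hq')
          rw [(Finset.mem_filter.1 he).2, (Finset.mem_filter.1 he').2]
        · exact fun e _ => dec.measurableSet_region _
    _ = _ := by simp [Fintype.card_embedding_eq]

/-- The probability of correct decoding, compared with a reference channel `fQ` that does not use
the column of the entry `i₀`. -/
lemma one_sub_errorProb_le {p k n : ℕ} (hkp : k ≤ p) (i₀ : Fin k) {g : ℝ → ℝ}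
    (hg : Measurable g) {σ : ℝ} {ν : Measure ℝ} [IsProbabilityMeasure ν] {f fQ : ℝ → ℝ → ℝ}
    (hf : IsChannelDensity g σ ν f) (hQm : Measurable fQ.uncurry) (hQpos : ∀ t y, 0 < fQ t y)
    (hQ1 : ∀ t, ∫⁻ y, ENNReal.ofReal (fQ t y) ∂ν = 1) (b : Fin k → ℝ) (dec : Decoder p n)
    {c ρ R : ℝ} (hc : 0 < c) (hρ : 0 < ρ) (hR0 : 0 ≤ R)
    (hR : ∀ e : Fin k ↪ Fin p, ∫⁻ x, ∫⁻ y, ENNReal.ofReal (f (∑ i, x (e i) * b i) y ^ (1 + ρ) *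
      fQ (∑ i : {i // i ≠ i₀}, x (e i) * b i) y ^ (-ρ)) ∂ν
        ∂(Measure.pi fun _ : Fin p => gaussianReal 0 1) ≤ ENNReal.ofReal R) :
    1 - errorProb g σ b dec ≤ c / ((p : ℝ) - k + 1) + c ^ (-ρ) * R ^ n := by
  set m : Measure ((Fin p → ℝ) × ℝ) :=
    (Measure.pi fun _ : Fin p => gaussianReal 0 1).prod ν with hm
  set P : (Fin k ↪ Fin p) → (Fin p → ℝ) × ℝ → ℝ :=
    fun e ω => f (∑ j, ω.1 j * embSignal b e j) ω.2 with hP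
  set Q : ({i : Fin k // i ≠ i₀} ↪ Fin p) → (Fin p → ℝ) × ℝ → ℝ :=
    fun r ω => fQ (∑ i : {i // i ≠ i₀}, ω.1 (r i) * b i) ω.2 with hQ
  have hPm : ∀ e, Measurable (P e) := fun e => hf.measurable.comp
    (f := fun ω : (Fin p → ℝ) × ℝ => (∑ j, ω.1 j * embSignal b e j, ω.2)) (by fun_prop)
  have hQm' : ∀ r, Measurable (Q r) := fun r => hQm.comp
    (f := fun ω : (Fin p → ℝ) × ℝ => (∑ i : {i // i ≠ i₀}, ω.1 (r i) * b i, ω.2)) (by fun_prop)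
  have hPprob : ∀ e, IsProbabilityMeasure (m.withDensity fun ω => ENNReal.ofReal (P e ω)) := by
    intro e
    rw [hm, hP, ← map_rowObs_eq_withDensity hg hf]
    exact Measure.isProbabilityMeasure_map (measurable_rowObs hg _).aemeasurable
  have hQprob : ∀ r, IsProbabilityMeasure (m.withDensity fun ω => ENNReal.ofReal (Q r ω)) := by
    intro r
    constructor
    rw [withDensity_apply _ MeasurableSet.univ, setLIntegral_univ, hm,
      lintegral_prod _ (hQm' r).ennreal_ofReal.aemeasurable]
    simp [hQ, hQ1]
  have key : ∀ e : Fin k ↪ Fin p,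
      (Measure.pi fun _ : Fin n => (rowLaw p σ).map (rowObs g (embSignal b e))).real
        (dec.region (Finset.univ.map e)) ≤
      c * (Measure.pi fun _ : Fin n => m.withDensity fun ω =>
        ENNReal.ofReal (Q (restPositions i₀ e) ω)).real (dec.region (Finset.univ.map e)) +
      c ^ (-ρ) * R ^ n := by
    intro e
    have h1 := pi_withDensity_le (n := n) m (hPm e) (hQm' (restPositions i₀ e))
      (fun _ => (hf.pos _ _).le) (fun _ => hQpos _ _) hc hρ
      (dec.measurableSet_region (Finset.univ.map e))
    have h2 : ∫⁻ ω, ENNReal.ofReal (P e ω ^ (1 + ρ) * Q (restPositions i₀ e) ω ^ (-ρ)) ∂m ≤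
        ENNReal.ofReal R := by
      have hmeas : Measurable fun ω =>
          ENNReal.ofReal (P e ω ^ (1 + ρ) * Q (restPositions i₀ e) ω ^ (-ρ)) := by
        have := hPm e
        have := hQm' (restPositions i₀ e)
        fun_prop
      rw [hm, lintegral_prod _ hmeas.aemeasurable]
      simp only [hP, hQ, sum_mul_embSignal]
      exact hR e
    rw [map_rowObs_eq_withDensity hg hf]
    have h3 := h1.trans (add_le_add_right (mul_le_mul_right (pow_le_pow_left' h2 n)
      (ENNReal.ofReal (c ^ (-ρ)))) _)
    have hcR : 0 ≤ c ^ (-ρ) := Real.rpow_nonneg hc.le _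
    refine ENNReal.toReal_le_of_le_ofReal (by positivity) (h3.trans_eq ?_)
    rw [ENNReal.ofReal_add (by positivity) (by positivity), ENNReal.ofReal_mul hc.le,
      ENNReal.ofReal_mul hcR, ENNReal.ofReal_pow hR0, ofReal_measureReal]
  have hk : k = k - 1 + 1 := by have := i₀.pos; omega
  have hpos : (0 : ℝ) < p.descFactorial k := by exact_mod_cast Nat.descFactorial_pos.2 hkp
  have hpos' : (0 : ℝ) < p.descFactorial (k - 1) := by
    exact_mod_cast Nat.descFactorial_pos.2 ((Nat.sub_le _ _).trans hkp)
  -- The factor p - k + 1 counts the columns left for `i₀`; it is the gain of the converse.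
  have hsucc : (p.descFactorial k : ℝ) = ((p : ℝ) - k + 1) * p.descFactorial (k - 1) := by
    conv_lhs => rw [hk, Nat.descFactorial_succ]
    rw [Nat.cast_mul, Nat.cast_sub (by omega), Nat.cast_sub (by omega)]
    push_cast
    ring
  have hpk : (0 : ℝ) < (p : ℝ) - k + 1 := by
    have : (k : ℝ) ≤ p := by exact_mod_cast hkp
    linarith
  rw [one_sub_errorProb hkp hg, div_le_iff₀ hpos]
  refine (Finset.sum_le_sum fun e _ => key e).trans ?_
  rw [Finset.sum_add_distrib, ← Finset.mul_sum, Finset.sum_const, nsmul_eq_mul, Finset.card_univ,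
    Fintype.card_embedding_eq, Fintype.card_fin, Fintype.card_fin, add_mul]
  have hs := sum_restPositions_le i₀ dec (fun r => Measure.pi fun _ : Fin n =>
    m.withDensity fun ω => ENNReal.ofReal (Q r ω))
  refine add_le_add ?_ (mul_comm _ _).le
  refine (mul_le_mul_of_nonneg_left hs hc.le).trans_eq ?_
  rw [hsucc]
  field_simp

/-! ### Gaussian integrals -/

lemma gaussianPDFReal_mul_exp_sq {v : ℝ≥0} (hv : v ≠ 0) (s x : ℝ) :
    gaussianPDFReal 0 v x * Real.exp (s * x ^ 2) =
      (√(2 * Real.pi * v))⁻¹ * Real.exp (-((2 * v : ℝ)⁻¹ - s) * x ^ 2) := by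
  have hv' : (v : ℝ) ≠ 0 := by exact_mod_cast hv
  rw [gaussianPDFReal, mul_assoc, ← Real.exp_add]
  congr 2
  field_simp
  ring

lemma integrable_exp_sq_gaussianReal {v : ℝ≥0} (hv : v ≠ 0) {s : ℝ} (hs : 2 * s * v < 1) :
    Integrable (fun x => Real.exp (s * x ^ 2)) (gaussianReal 0 v) := by
  have hv' : (0 : ℝ) < v := by exact_mod_cast pos_of_ne_zero hv
  rw [gaussianReal_of_var_ne_zero _ hv, integrable_withDensity_iff_integrable_smul'
    (measurable_gaussianPDF 0 v) (ae_of_all _ fun _ => gaussianPDF_lt_top)]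
  simp only [toReal_gaussianPDF, smul_eq_mul, gaussianPDFReal_mul_exp_sq hv]
  refine (integrable_exp_neg_mul_sq ?_).const_mul _
  have h2 : (2 * v : ℝ)⁻¹ - s = (1 - 2 * s * v) / (2 * v) := by field_simp
  rw [h2]
  exact div_pos (by linarith) (by positivity)

lemma integral_exp_sq_gaussianReal {v : ℝ≥0} (hv : v ≠ 0) {s : ℝ} (hs : 2 * s * v < 1) :
    ∫ x, Real.exp (s * x ^ 2) ∂(gaussianReal 0 v) = (√(1 - 2 * s * v))⁻¹ := by
  have hv' : (0 : ℝ) < v := by exact_mod_cast pos_of_ne_zero hv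
  rw [integral_gaussianReal_eq_integral_smul hv]
  simp only [smul_eq_mul, gaussianPDFReal_mul_exp_sq hv]
  rw [integral_const_mul, integral_gaussian, ← Real.sqrt_inv, ← Real.sqrt_inv,
    ← Real.sqrt_mul (by positivity)]
  congr 1
  have h1 : (1 - 2 * s * v) ≠ 0 := by linarith
  have h2 : (2 * v : ℝ)⁻¹ - s = (1 - 2 * s * v) / (2 * v) := by field_simp
  rw [h2]
  field_simp

lemma integrable_abs_pow_gaussianReal (v : ℝ≥0) (r : ℕ) :
    Integrable (fun x : ℝ => |x| ^ r) (gaussianReal 0 v) := by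
  rcases eq_or_ne r 0 with rfl | hr
  · simp
  · have := (memLp_id_gaussianReal' (μ := 0) (v := v) (r : ℝ≥0∞) (by simp)).integrable_norm_pow hr
    simpa using this

/-- The absolute moments of the standard normal law. -/
def absMoment (r : ℕ) : ℝ := ∫ x, |x| ^ r ∂(gaussianReal 0 1)

lemma absMoment_nonneg (r : ℕ) : 0 ≤ absMoment r :=
  integral_nonneg fun _ => by positivity

lemma absMoment_two : absMoment 2 = 1 := by
  have h := variance_fun_id_gaussianReal (μ := 0) (v := 1)
  rw [variance_of_integral_eq_zero (by fun_prop) (by simp)] at h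
  simpa [absMoment] using h

/-- This is the square root of 1 + x ≤ exp x at x = u/(1-u). It makes the Gaussian moments
exponential, both in the converse and in the Chernoff bound of the linear model. -/
lemma inv_sqrt_one_sub_le {u : ℝ} (hu : u < 1) :
    (√(1 - u))⁻¹ ≤ Real.exp (u / (2 * (1 - u))) := by
  have h1 : 0 < 1 - u := by linarith
  have h2 : u / (1 - u) + 1 ≤ Real.exp (u / (1 - u)) := Real.add_one_le_exp _
  have h3 : u / (1 - u) + 1 = (1 - u)⁻¹ := by field_simp; ring
  rw [← Real.sqrt_inv, ← h3]
  refine (Real.sqrt_le_sqrt h2).trans_eq ?_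
  rw [Real.sqrt_eq_iff_mul_self_eq (Real.exp_pos _).le (Real.exp_pos _).le, ← Real.exp_add]
  congr 1
  field_simp
  ring

/-! ### A second-order Bernoulli inequality -/

lemma one_add_rpow_le_of_nonneg {ρ r : ℝ} (hρ : 0 < ρ) (hρ1 : ρ ≤ 1) (hr : 0 ≤ r) :
    (1 + r) ^ (1 + ρ) ≤ 1 + (1 + ρ) * r + ρ * (1 + ρ) / 2 * r ^ 2 := by
  set φ : ℝ → ℝ := fun r => 1 + (1 + ρ) * r + ρ * (1 + ρ) / 2 * r ^ 2 - (1 + r) ^ (1 + ρ) with hφ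
  have hd : ∀ x : ℝ, 0 ≤ x →
      HasDerivAt φ ((1 + ρ) * 1 + ρ * (1 + ρ) / 2 * (2 * x) -
        1 * (1 + ρ) * (1 + x) ^ (1 + ρ - 1)) x := by
    intro x hx
    have h1 : HasDerivAt (fun r : ℝ => 1 + r) 1 x := (hasDerivAt_id x).const_add 1
    have h2 := h1.rpow_const (p := 1 + ρ) (Or.inl (by positivity))
    have h3 : HasDerivAt (fun r : ℝ => r ^ 2) (2 * x) x := by simpa using hasDerivAt_pow 2 x
    exact (((((hasDerivAt_id x).const_mul (1 + ρ)).const_add 1).add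
      (h3.const_mul (ρ * (1 + ρ) / 2))).sub h2)
  have hmono : MonotoneOn φ (Set.Ici 0) := by
    refine monotoneOn_of_deriv_nonneg (convex_Ici 0)
      (fun x hx => (hd x hx).continuousAt.continuousWithinAt)
      (fun x hx => (hd x (interior_subset hx)).differentiableAt.differentiableWithinAt)
      fun x hx => ?_
    have hx0 : (0 : ℝ) ≤ x := interior_subset hx
    rw [(hd x hx0).deriv]
    -- The derivative is (1+ρ)(1 + ρx - (1+x)^ρ), nonnegative by Bernoulli's inequality for
    -- exponents at most 1.
    have hb := rpow_one_add_le_one_add_mul_self (s := x) (by linarith) hρ.le hρ1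
    have : 1 + ρ - 1 = ρ := by ring
    rw [this]
    nlinarith
  have := hmono Set.self_mem_Ici hr hr
  simp only [hφ] at this
  norm_num at this
  linarith

lemma one_sub_rpow_le {ρ s : ℝ} (hρ : 0 < ρ) (hρ1 : ρ ≤ 1) (hs : 0 ≤ s) (hs1 : s ≤ 1) :
    (1 - s) ^ (1 + ρ) ≤ 1 - (1 + ρ) * s + ρ * (1 + ρ) / 2 * s ^ 2 + s ^ 3 := by
  set φ : ℝ → ℝ :=
    fun s => 1 - (1 + ρ) * s + ρ * (1 + ρ) / 2 * s ^ 2 + s ^ 3 - (1 - s) ^ (1 + ρ) with hφ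
  have hd : ∀ x : ℝ, HasDerivAt φ (-((1 + ρ) * 1) + ρ * (1 + ρ) / 2 * (2 * x) + 3 * x ^ 2 -
        (-1) * (1 + ρ) * (1 - x) ^ (1 + ρ - 1)) x := by
    intro x
    have h1 : HasDerivAt (fun r : ℝ => 1 - r) (-1) x := (hasDerivAt_id x).const_sub 1
    have h2 := h1.rpow_const (p := 1 + ρ) (Or.inr (by linarith))
    have h3 : HasDerivAt (fun r : ℝ => r ^ 2) (2 * x) x := by simpa using hasDerivAt_pow 2 x
    have h4 : HasDerivAt (fun r : ℝ => r ^ 3) (3 * x ^ 2) x := by simpa using hasDerivAt_pow 3 x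
    exact ((((((hasDerivAt_id x).const_mul (1 + ρ)).const_sub 1).add
      (h3.const_mul (ρ * (1 + ρ) / 2))).add h4).sub h2)
  have hmono : MonotoneOn φ (Set.Icc 0 1) := by
    refine monotoneOn_of_deriv_nonneg (convex_Icc 0 1)
      (fun x hx => (hd x).continuousAt.continuousWithinAt)
      (fun x hx => (hd x).differentiableAt.differentiableWithinAt)
      fun x hx => ?_
    rw [interior_Icc] at hx
    obtain ⟨hx0, hx1⟩ := hx
    rw [(hd x).deriv]
    have h1x : 0 < 1 - x := by linarith
    -- A lower bound on (1-x)^ρ is needed here, and Bernoulli gives upper bounds; so it is applied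
    -- to the reciprocal (1-x)⁻¹.
    have hb := rpow_one_add_le_one_add_mul_self (s := (1 - x)⁻¹ - 1)
      (by have := inv_pos.2 h1x; linarith) hρ.le hρ1
    have hb' : 1 - ρ * x - (1 - ρ) * x ^ 2 ≤ (1 - x) ^ ρ := by
      have hpos : 0 < (1 - x) ^ ρ := Real.rpow_pos_of_pos h1x ρ
      rw [add_sub_cancel, Real.inv_rpow h1x.le, inv_le_comm₀ hpos] at hb
      · refine le_trans ?_ hb
        have e : 1 + ρ * ((1 - x)⁻¹ - 1) = (1 - (1 - ρ) * x) / (1 - x) := by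
          field_simp; ring
        have hden : 0 < 1 - (1 - ρ) * x := by nlinarith
        rw [e, inv_div, le_div_iff₀ hden]
        have : 0 ≤ ρ * (1 - ρ) * x ^ 2 := by
          have : 0 ≤ 1 - ρ := by linarith
          positivity
        have : 0 ≤ (1 - ρ) ^ 2 * x ^ 2 * (1 - x) := by positivity
        nlinarith
      · have : 1 < (1 - x)⁻¹ := (one_lt_inv₀ h1x).2 (by linarith)
        have : 0 < (1 - x)⁻¹ - 1 := by linarith
        positivity
    have : 1 + ρ - 1 = ρ := by ring
    rw [this]
    nlinarith [sq_nonneg x, mul_nonneg hρ.le (sq_nonneg x), sq_nonneg (ρ * x)]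
  have := hmono (Set.left_mem_Icc.2 zero_le_one) ⟨hs, hs1⟩ hs
  simp only [hφ] at this
  norm_num at this
  linarith

/-- The quadratic coefficient is the exact Taylor coefficient, which keeps the converse constant
sharp; the remainder is cubic uniformly down to `r = -1`. -/
lemma one_add_rpow_le {ρ r : ℝ} (hρ : 0 < ρ) (hρ1 : ρ ≤ 1) (hr : -1 ≤ r) :
    (1 + r) ^ (1 + ρ) ≤ 1 + (1 + ρ) * r + ρ * (1 + ρ) / 2 * r ^ 2 + |r| ^ 3 := by
  rcases le_total 0 r with h | h
  · have := one_add_rpow_le_of_nonneg hρ hρ1 h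
    have : 0 ≤ |r| ^ 3 := by positivity
    linarith
  · have := one_sub_rpow_le hρ hρ1 (neg_nonneg.2 h) (by linarith)
    rw [abs_of_nonpos h]
    convert this using 1 <;> ring_nf

lemma toNNReal_sq_ne_zero {σ : ℝ} (hσ : 0 < σ) : Real.toNNReal (σ ^ 2) ≠ 0 := by
  rw [Ne, Real.toNNReal_eq_zero, not_le]
  positivity

lemma coe_toNNReal_sq (σ : ℝ) : ((Real.toNNReal (σ ^ 2) : ℝ≥0) : ℝ) = σ ^ 2 :=
  Real.coe_toNNReal _ (sq_nonneg σ)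

/-! ### The linear channel -/

/-- The density of `N(t, σ²)` with respect to `N(0, σ²)`. -/
def linearDensity (σ t y : ℝ) : ℝ := Real.exp ((t * y - t ^ 2 / 2) / σ ^ 2)

lemma measurable_linearDensity (σ : ℝ) : Measurable (linearDensity σ).uncurry := by
  unfold linearDensity
  fun_prop

lemma isChannelDensity_linear {σ : ℝ} (hσ : 0 < σ) :
    IsChannelDensity id σ (gaussianReal 0 (Real.toNNReal (σ ^ 2))) (linearDensity σ) where
  measurable := measurable_linearDensity σ
  pos t y := Real.exp_pos _
  map_eq t := by
    have hv := toNNReal_sq_ne_zero hσ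
    have hm : Measurable fun y => ENNReal.ofReal (linearDensity σ t y) := by
      unfold linearDensity; fun_prop
    simp only [id]
    rw [gaussianReal_map_const_add, gaussianReal_of_var_ne_zero _ hv,
      gaussianReal_of_var_ne_zero _ hv, ← withDensity_mul _ (measurable_gaussianPDF 0 _) hm]
    congr 1
    ext y
    rw [Pi.mul_apply, gaussianPDF, gaussianPDF, ← ENNReal.ofReal_mul (gaussianPDFReal_nonneg _ _ _)]
    congr 1
    rw [gaussianPDFReal, gaussianPDFReal, linearDensity, mul_assoc (_)⁻¹, ← Real.exp_add,
      coe_toNNReal_sq]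
    congr 2
    field_simp
    ring

/-- By translation invariance the moment depends on the shift `h` only, so the known part `a` of the
signal drops out. -/
lemma lintegral_linearDensity_rpow {σ : ℝ} (hσ : 0 < σ) (ρ a h : ℝ) :
    ∫⁻ y, ENNReal.ofReal (linearDensity σ (a + h) y ^ (1 + ρ) * linearDensity σ a y ^ (-ρ))
      ∂(gaussianReal 0 (Real.toNNReal (σ ^ 2))) =
      ENNReal.ofReal (Real.exp (ρ * (1 + ρ) / (2 * σ ^ 2) * h ^ 2)) := by
  have e : ∀ y, linearDensity σ (a + h) y ^ (1 + ρ) * linearDensity σ a y ^ (-ρ) =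
      Real.exp (-((1 + ρ) * (a + h) ^ 2 - ρ * a ^ 2) / (2 * σ ^ 2)) *
        Real.exp ((a + (1 + ρ) * h) / σ ^ 2 * y) := by
    intro y
    rw [linearDensity, linearDensity, ← Real.exp_mul, ← Real.exp_mul, ← Real.exp_add,
      ← Real.exp_add]
    congr 1
    field_simp
    ring
  simp_rw [e]
  rw [← ofReal_integral_eq_lintegral_ofReal
    ((integrable_exp_mul_gaussianReal _).const_mul _) (ae_of_all _ fun _ => by positivity),
    integral_const_mul]
  have := congrFun (mgf_fun_id_gaussianReal (μ := 0) (v := Real.toNNReal (σ ^ 2)))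
    ((a + (1 + ρ) * h) / σ ^ 2)
  rw [mgf, coe_toNNReal_sq] at this
  rw [this, ← Real.exp_add]
  congr 2
  field_simp
  ring

lemma lintegral_linearDensity {σ : ℝ} (hσ : 0 < σ) (t : ℝ) :
    ∫⁻ y, ENNReal.ofReal (linearDensity σ t y) ∂(gaussianReal 0 (Real.toNNReal (σ ^ 2))) = 1 := by
  -- With ρ = 0 and h = 0 the moment is the total mass.
  have := lintegral_linearDensity_rpow hσ 0 t 0
  simpa using this

lemma sum_eq_rest_add {p k : ℕ} (i₀ : Fin k) (b : Fin k → ℝ) (e : Fin k ↪ Fin p)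
    (x : Fin p → ℝ) : ∑ i, x (e i) * b i =
      (∑ i : {i // i ≠ i₀}, x (e i) * b i) + x (e i₀) * b i₀ := by
  rw [Fintype.sum_eq_add_sum_subtype_ne (fun i => x (e i) * b i) i₀, add_comm]

lemma lintegral_linear_le {p k : ℕ} (i₀ : Fin k) (b : Fin k → ℝ) {σ : ℝ} (hσ : 0 < σ) {ρ : ℝ}
    (hu : ρ * (1 + ρ) * b i₀ ^ 2 / σ ^ 2 < 1) (e : Fin k ↪ Fin p) :
    ∫⁻ x, ∫⁻ y, ENNReal.ofReal (linearDensity σ (∑ i, x (e i) * b i) y ^ (1 + ρ) *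
      linearDensity σ (∑ i : {i // i ≠ i₀}, x (e i) * b i) y ^ (-ρ))
        ∂(gaussianReal 0 (Real.toNNReal (σ ^ 2)))
        ∂(Measure.pi fun _ : Fin p => gaussianReal 0 1) ≤
      ENNReal.ofReal (√(1 - ρ * (1 + ρ) * b i₀ ^ 2 / σ ^ 2))⁻¹ := by
  simp_rw [sum_eq_rest_add i₀ b e, lintegral_linearDensity_rpow hσ]
  have h1 : 2 * (ρ * (1 + ρ) / (2 * σ ^ 2) * b i₀ ^ 2) * ((1 : ℝ≥0) : ℝ) =
      ρ * (1 + ρ) * b i₀ ^ 2 / σ ^ 2 := by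
    push_cast
    field_simp
  have h2 := (measurePreserving_eval (fun _ : Fin p => gaussianReal 0 1) (e i₀)).lintegral_comp
    (f := fun x => ENNReal.ofReal (Real.exp (ρ * (1 + ρ) / (2 * σ ^ 2) * b i₀ ^ 2 * x ^ 2)))
    (by fun_prop)
  have h3 : ∀ x : ℝ, ρ * (1 + ρ) / (2 * σ ^ 2) * (x * b i₀) ^ 2 =
      ρ * (1 + ρ) / (2 * σ ^ 2) * b i₀ ^ 2 * x ^ 2 := fun x => by ring
  simp_rw [h3]
  refine (h2.trans ?_).le
  rw [← ofReal_integral_eq_lintegral_ofReal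
    (integrable_exp_sq_gaussianReal one_ne_zero (by rw [h1]; exact hu))
    (ae_of_all _ fun _ => by positivity),
    integral_exp_sq_gaussianReal one_ne_zero (by rw [h1]; exact hu), h1]

/-- The converse bound of the linear model. -/
lemma one_sub_errorProb_linear_le {p k n : ℕ} (hkp : k ≤ p) (i₀ : Fin k) (b : Fin k → ℝ) {σ : ℝ}
    (hσ : 0 < σ) (dec : Decoder p n) {c ρ : ℝ} (hc : 0 < c) (hρ : 0 < ρ)
    (hu : ρ * (1 + ρ) * b i₀ ^ 2 / σ ^ 2 < 1) :
    1 - errorProb id σ b dec ≤ c / ((p : ℝ) - k + 1) +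
      c ^ (-ρ) * (√(1 - ρ * (1 + ρ) * b i₀ ^ 2 / σ ^ 2))⁻¹ ^ n :=
  one_sub_errorProb_le hkp i₀ measurable_id (isChannelDensity_linear hσ)
    (measurable_linearDensity σ) (fun _ _ => Real.exp_pos _) (lintegral_linearDensity hσ) b dec
    hc hρ (by positivity) (lintegral_linear_le i₀ b hσ hu)

/-! ### The 1-bit channel -/

/-- The probability that `t + Z` is non-negative. -/
def posProb (σ t : ℝ) : ℝ := (gaussianReal 0 (Real.toNNReal (σ ^ 2))).real (Set.Ici (-t))

/-- The maximal density of the noise. -/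
def peak (σ : ℝ) : ℝ := (√(2 * Real.pi * σ ^ 2))⁻¹

lemma peak_pos {σ : ℝ} (hσ : 0 < σ) : 0 < peak σ := by
  unfold peak
  have := Real.pi_pos
  positivity

lemma peak_sq (σ : ℝ) : peak σ ^ 2 = (2 * Real.pi * σ ^ 2)⁻¹ := by
  have := Real.pi_pos
  rw [peak, inv_pow, Real.sq_sqrt (by positivity)]

lemma posProb_mono (σ : ℝ) : Monotone (posProb σ) := fun s t hst =>
  measureReal_mono (Set.Ici_subset_Ici.2 (neg_le_neg hst))

lemma gaussianReal_real_Ico_le {σ : ℝ} (hσ : 0 < σ) {s t : ℝ} (hst : s ≤ t) :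
    (gaussianReal 0 (Real.toNNReal (σ ^ 2))).real (Set.Ico s t) ≤ peak σ * (t - s) := by
  have hpk := (peak_pos hσ).le
  refine ENNReal.toReal_le_of_le_ofReal (mul_nonneg hpk (by linarith)) ?_
  rw [gaussianReal_apply _ (toNNReal_sq_ne_zero hσ)]
  calc _ ≤ ∫⁻ _ in Set.Ico s t, ENNReal.ofReal (peak σ) := by
        refine lintegral_mono fun x => ENNReal.ofReal_le_ofReal ?_
        rw [gaussianPDFReal, coe_toNNReal_sq, peak]
        refine mul_le_of_le_one_right (by positivity) (Real.exp_le_one_iff.2 ?_)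
        exact div_nonpos_of_nonpos_of_nonneg (neg_nonpos.2 (sq_nonneg _)) (by positivity)
    _ = _ := by rw [setLIntegral_const, Real.volume_Ico, ENNReal.ofReal_mul hpk]

/-- The increment is the noise mass of an interval, at most its length times the peak density. The
square of this Lipschitz constant, 1/(2πσ²), is the source of π in the 1-bit threshold. -/
lemma posProb_sub_le {σ : ℝ} (hσ : 0 < σ) {s t : ℝ} (hst : s ≤ t) :
    posProb σ t - posProb σ s ≤ peak σ * (t - s) := by
  have hU : Set.Ici (-t) = Set.Ico (-t) (-s) ∪ Set.Ici (-s) :=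
    (Set.Ico_union_Ici_eq_Ici (neg_le_neg hst)).symm
  have h1 := measureReal_union_le (μ := gaussianReal 0 (Real.toNNReal (σ ^ 2)))
    (Set.Ico (-t) (-s)) (Set.Ici (-s))
  rw [← hU] at h1
  have h2 := gaussianReal_real_Ico_le hσ (neg_le_neg hst)
  unfold posProb
  linarith

lemma abs_posProb_sub_le {σ : ℝ} (hσ : 0 < σ) (s t : ℝ) :
    |posProb σ t - posProb σ s| ≤ peak σ * |t - s| := by
  rcases le_total s t with h | h
  · rw [abs_of_nonneg (sub_nonneg.2 h), abs_of_nonneg (sub_nonneg.2 (posProb_mono σ h))]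
    exact posProb_sub_le hσ h
  · rw [abs_of_nonpos (sub_nonpos.2 h), abs_of_nonpos (sub_nonpos.2 (posProb_mono σ h)), neg_sub,
      neg_sub]
    exact posProb_sub_le hσ h

lemma gaussianReal_real_Iio (σ t : ℝ) :
    (gaussianReal 0 (Real.toNNReal (σ ^ 2))).real (Set.Iio (-t)) = 1 - posProb σ t := by
  rw [posProb, ← probReal_compl_eq_one_sub measurableSet_Ici, Set.compl_Ici]

lemma posProb_neg {σ : ℝ} (hσ : 0 < σ) (t : ℝ) : posProb σ (-t) = 1 - posProb σ t := by
  have hn := nullSingletonClass_gaussianReal (μ := 0) (toNNReal_sq_ne_zero hσ)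
  have h : (gaussianReal 0 (Real.toNNReal (σ ^ 2))).real (Set.Iic (-t)) = posProb σ (-t) := by
    have := gaussianReal_map_neg (μ := 0) (v := Real.toNNReal (σ ^ 2))
    rw [neg_zero] at this
    rw [posProb, ← this, map_measureReal_apply measurable_neg measurableSet_Ici, this]
    congr 1
    ext x
    simp
  rw [← h, ← gaussianReal_real_Iio]
  exact (measureReal_congr Iio_ae_eq_Iic).symm

lemma posProb_zero {σ : ℝ} (hσ : 0 < σ) : posProb σ 0 = 1 / 2 := by
  have := posProb_neg hσ 0
  rw [neg_zero] at this
  linarith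

lemma posProb_pos {σ : ℝ} (hσ : 0 < σ) (t : ℝ) : 0 < posProb σ t := by
  rw [posProb, measureReal_def, ENNReal.toReal_pos_iff]
  refine ⟨pos_iff_ne_zero.2 fun h => ?_, measure_lt_top _ _⟩
  have := gaussianReal_absolutelyContinuous' 0 (toNNReal_sq_ne_zero hσ) h
  simp at this

lemma posProb_lt_one {σ : ℝ} (hσ : 0 < σ) (t : ℝ) : posProb σ t < 1 := by
  have := posProb_pos hσ (-t)
  rw [posProb_neg hσ] at this
  linarith

/-- The uniform law on `{1, -1}`. -/
def signLaw : Measure ℝ :=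
  (2⁻¹ : ℝ≥0∞) • Measure.dirac 1 + (2⁻¹ : ℝ≥0∞) • Measure.dirac (-1)

instance : IsProbabilityMeasure signLaw := ⟨by simp [signLaw, ENNReal.inv_two_add_inv_two]⟩

/-- The density with respect to `signLaw` of the law of total mass one that gives `1` the
mass `q`. -/
def signDensity (q y : ℝ) : ℝ := if y = 1 then 2 * q else 2 * (1 - q)

lemma measurable_signDensity {q : ℝ → ℝ} (hq : Measurable q) :
    Measurable fun x : ℝ × ℝ => signDensity (q x.1) x.2 := by
  unfold signDensity
  exact Measurable.ite (measurable_snd (measurableSet_singleton 1)) (by fun_prop) (by fun_prop)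

lemma signDensity_pos {q : ℝ} (h0 : 0 < q) (h1 : q < 1) (y : ℝ) : 0 < signDensity q y := by
  unfold signDensity
  split_ifs <;> linarith

lemma lintegral_signLaw (F : ℝ → ℝ) (h1 : 0 ≤ F 1) (h2 : 0 ≤ F (-1)) :
    ∫⁻ y, ENNReal.ofReal (F y) ∂signLaw = ENNReal.ofReal ((F 1 + F (-1)) / 2) := by
  have h2' : (2⁻¹ : ℝ≥0∞) = ENNReal.ofReal 2⁻¹ := by
    rw [ENNReal.ofReal_inv_of_pos (by norm_num)]; simp
  rw [signLaw, lintegral_add_measure, lintegral_smul_measure, lintegral_smul_measure,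
    lintegral_dirac, lintegral_dirac, h2', smul_eq_mul, smul_eq_mul,
    ← ENNReal.ofReal_mul (by norm_num), ← ENNReal.ofReal_mul (by norm_num),
    ← ENNReal.ofReal_add (by positivity) (by positivity)]
  congr 1
  ring

lemma lintegral_signDensity {q : ℝ} (h0 : 0 < q) (h1 : q < 1) :
    ∫⁻ y, ENNReal.ofReal (signDensity q y) ∂signLaw = 1 := by
  rw [lintegral_signLaw _ (signDensity_pos h0 h1 _).le (signDensity_pos h0 h1 _).le]
  norm_num [signDensity]
  ring

lemma isChannelDensity_sgn {σ : ℝ} (hσ : 0 < σ) :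
    IsChannelDensity sgn σ signLaw fun t y => signDensity (posProb σ t) y where
  measurable := measurable_signDensity (posProb_mono σ).measurable
  pos t y := signDensity_pos (posProb_pos hσ t) (posProb_lt_one hσ t) y
  map_eq t := by
    have hm : Measurable fun z => sgn (t + z) := measurable_sgn.comp (by fun_prop)
    have hd : Measurable fun y => signDensity (posProb σ t) y := by
      unfold signDensity
      exact Measurable.ite (measurableSet_singleton 1) measurable_const measurable_const
    ext A hA
    rw [Measure.map_apply hm hA, withDensity_apply _ hA, ← lintegral_indicator hA]
    have h0 := posProb_pos hσ t
    have h1 := posProb_lt_one hσ t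
    have hind : ∀ y, A.indicator (fun y => ENNReal.ofReal (signDensity (posProb σ t) y)) y =
        ENNReal.ofReal (A.indicator (signDensity (posProb σ t)) y) := fun y => by
      by_cases hy : y ∈ A <;> simp [hy]
    simp_rw [hind]
    have hnn : ∀ y, 0 ≤ A.indicator (signDensity (posProb σ t)) y := fun y =>
      Set.indicator_nonneg (fun y _ => (signDensity_pos h0 h1 y).le) y
    rw [lintegral_signLaw _ (hnn _) (hnn _), ← ofReal_measureReal]
    congr 1
    have hpre1 : ∀ z, 0 ≤ t + z ↔ z ∈ Set.Ici (-t) := fun z => by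
      rw [Set.mem_Ici, neg_le_iff_add_nonneg']
    have hne : (-1 : ℝ) ≠ 1 := by norm_num
    have hIio : Set.Iio (-t) = (Set.Ici (-t))ᶜ := by simp
    -- Both laws live on {1, -1}, so only the membership of these two points in `A` matters.
    by_cases hp : (1 : ℝ) ∈ A <;> by_cases hq : (-1 : ℝ) ∈ A
    · have : (fun z => sgn (t + z)) ⁻¹' A = Set.univ := by
        ext z; simp only [Set.mem_preimage, sgn]; split_ifs <;> simp [hp, hq]
      simp [this, hp, hq, signDensity, hne]; ring
    · have : (fun z => sgn (t + z)) ⁻¹' A = Set.Ici (-t) := by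
        ext z; simp only [Set.mem_preimage, sgn, ← hpre1]; split_ifs with hz <;> simp [hp, hq, hz]
      simp [this, hp, hq, signDensity, posProb]
    · have : (fun z => sgn (t + z)) ⁻¹' A = Set.Iio (-t) := by
        ext z
        simp only [Set.mem_preimage, sgn, hIio, Set.mem_compl_iff, ← hpre1]
        split_ifs with hz <;> simp [hp, hq, hz]
      simp [this, hp, hq, signDensity, hne, gaussianReal_real_Iio]
    · have : (fun z => sgn (t + z)) ⁻¹' A = ∅ := by
        ext z; simp only [Set.mem_preimage, sgn]; split_ifs <;> simp [hp, hq]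
      simp [this, hp, hq]

open Classical in
/-- The reference probability of the observation `1`: the 1-bit channel without the unknown
entry, replaced by a fair coin when the known part of the signal is large. -/
def clippedProb (σ ε t : ℝ) : ℝ := if peak σ * |t| ≤ ε then posProb σ t else 1 / 2

lemma measurable_clippedProb (σ ε : ℝ) : Measurable (clippedProb σ ε) := by
  unfold clippedProb
  exact Measurable.ite (measurableSet_le (by fun_prop) measurable_const)
    (posProb_mono σ).measurable measurable_const

lemma clippedProb_pos {σ : ℝ} (hσ : 0 < σ) (ε t : ℝ) : 0 < clippedProb σ ε t := by
  unfold clippedProb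
  split_ifs
  exacts [posProb_pos hσ t, by norm_num]

lemma clippedProb_lt_one {σ : ℝ} (hσ : 0 < σ) (ε t : ℝ) : clippedProb σ ε t < 1 := by
  unfold clippedProb
  split_ifs
  exacts [posProb_lt_one hσ t, by norm_num]

/-- This is q(1+r)^(1+ρ) expanded at the relative deviation r = (q'-q)/q. -/
lemma rpow_mul_rpow_le {ρ q q' : ℝ} (hρ : 0 < ρ) (hρ1 : ρ ≤ 1) (hq : 0 < q) (hq' : 0 < q') :
    q' ^ (1 + ρ) * q ^ (-ρ) ≤ q + (1 + ρ) * (q' - q) + ρ * (1 + ρ) / 2 * ((q' - q) ^ 2 / q) +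
      |q' - q| ^ 3 / q ^ 2 := by
  have h := one_add_rpow_le hρ hρ1 (r := (q' - q) / q) (by
    rw [le_div_iff₀ hq]; linarith)
  have e : 1 + (q' - q) / q = q' / q := by field_simp; ring
  rw [e, Real.div_rpow hq'.le hq.le, abs_div, abs_of_pos hq] at h
  have e2 : q' ^ (1 + ρ) * q ^ (-ρ) = q * (q' ^ (1 + ρ) / q ^ (1 + ρ)) := by
    rw [Real.rpow_neg hq.le, Real.rpow_add hq 1 ρ, Real.rpow_one]
    field_simp
  rw [e2]
  refine (mul_le_mul_of_nonneg_left h hq.le).trans_eq ?_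
  field_simp

/-- The linear terms of the two outcomes cancel and the quadratic ones add up through 1/q + 1/(1-q)
= 1/(q(1-q)), which is close to 4 near the fair coin. The constant 32 is 2·16, since both
probabilities are at least 1/4. -/
lemma binary_rpow_le {ρ q q' ε : ℝ} (hρ : 0 < ρ) (hρ1 : ρ ≤ 1) (hε : ε ≤ 1 / 4)
    (hq : |q - 1 / 2| ≤ ε) (h0 : 0 < q') (h1 : q' < 1) :
    q' ^ (1 + ρ) * q ^ (-ρ) + (1 - q') ^ (1 + ρ) * (1 - q) ^ (-ρ) ≤
      1 + ρ * (1 + ρ) / 2 * ((q' - q) ^ 2 / (1 / 4 - ε ^ 2)) + 32 * |q' - q| ^ 3 := by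
  obtain ⟨hl, hu⟩ := abs_le.1 hq
  have hq0 : 1 / 4 ≤ q := by linarith
  have hq1 : 1 / 4 ≤ 1 - q := by linarith
  have hε0 : 0 ≤ ε := (abs_nonneg _).trans hq
  have ha := rpow_mul_rpow_le hρ hρ1 (q := q) (q' := q') (by linarith) h0
  have hb := rpow_mul_rpow_le hρ hρ1 (q := 1 - q) (q' := 1 - q') (by linarith) (by linarith)
  have e1 : (1 - q') - (1 - q) = -(q' - q) := by ring
  rw [e1, abs_neg, neg_sq] at hb
  have h3 : ∀ x : ℝ, 1 / 4 ≤ x → |q' - q| ^ 3 / x ^ 2 ≤ 16 * |q' - q| ^ 3 := by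
    intro x hx
    have hx0 : 0 < x := by linarith
    rw [div_le_iff₀ (by positivity)]
    have : 1 ≤ 16 * x ^ 2 := by nlinarith
    have h3' : 0 ≤ |q' - q| ^ 3 := by positivity
    nlinarith
  have h2 : (q' - q) ^ 2 / q + (q' - q) ^ 2 / (1 - q) ≤ (q' - q) ^ 2 / (1 / 4 - ε ^ 2) := by
    have : (q' - q) ^ 2 / q + (q' - q) ^ 2 / (1 - q) = (q' - q) ^ 2 / (q * (1 - q)) := by
      have : q ≠ 0 := by linarith
      have : 1 - q ≠ 0 := by linarith
      field_simp
      ring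
    rw [this]
    refine div_le_div_of_nonneg_left (sq_nonneg _) (by nlinarith) ?_
    nlinarith
  have h4 := h3 q hq0
  have h5 := h3 (1 - q) hq1
  have h6 : 0 ≤ ρ * (1 + ρ) / 2 := by positivity
  nlinarith [mul_le_mul_of_nonneg_left h2 h6]

/-- For small `a` the binary expansion applies. For large `a` the reference is the fair coin and the
moment is at most 2, which the last term absorbs because it is then at least 1. The fourth power of
`a` makes its expectation of order b⁴, negligible against b²; a square would not be. -/
lemma lintegral_signDensity_rpow_le {σ : ℝ} (hσ : 0 < σ) {ρ ε : ℝ} (hρ : 0 < ρ) (hρ1 : ρ ≤ 1)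
    (hε0 : 0 < ε) (hε : ε ≤ 1 / 4) (a h : ℝ) :
    ∫⁻ y, ENNReal.ofReal (signDensity (posProb σ (a + h)) y ^ (1 + ρ) *
      signDensity (clippedProb σ ε a) y ^ (-ρ)) ∂signLaw ≤
      ENNReal.ofReal (1 + ρ * (1 + ρ) / 2 * (peak σ ^ 2 / (1 / 4 - ε ^ 2)) * h ^ 2 +
        32 * peak σ ^ 3 * |h| ^ 3 + (peak σ / ε) ^ 4 * a ^ 4) := by
  have h0 := posProb_pos hσ (a + h)
  have h1 := posProb_lt_one hσ (a + h)
  have hc0 := clippedProb_pos hσ ε a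
  have hc1 := clippedProb_lt_one hσ ε a
  have hpk := (peak_pos hσ).le
  have hnn : ∀ y, 0 ≤ signDensity (posProb σ (a + h)) y ^ (1 + ρ) *
      signDensity (clippedProb σ ε a) y ^ (-ρ) := fun y =>
    mul_nonneg (Real.rpow_nonneg (signDensity_pos h0 h1 y).le _)
      (Real.rpow_nonneg (signDensity_pos hc0 hc1 y).le _)
  rw [lintegral_signLaw _ (hnn _) (hnn _)]
  refine ENNReal.ofReal_le_ofReal ?_
  have e2 : ∀ x y : ℝ, 0 < x → 0 < y →
      (2 * x) ^ (1 + ρ) * (2 * y) ^ (-ρ) = 2 * (x ^ (1 + ρ) * y ^ (-ρ)) := by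
    intro x y hx hy
    rw [Real.mul_rpow zero_le_two hx.le, Real.mul_rpow zero_le_two hy.le, Real.rpow_neg zero_le_two,
      Real.rpow_add zero_lt_two, Real.rpow_one]
    have := Real.rpow_pos_of_pos zero_lt_two ρ
    field_simp
  have hs1 : ∀ q, signDensity q 1 = 2 * q := fun q => by simp [signDensity]
  have hs2 : ∀ q, signDensity q (-1) = 2 * (1 - q) := fun q => by norm_num [signDensity]
  rw [hs1, hs1, hs2, hs2, e2 _ _ h0 hc0, e2 _ _ (by linarith) (by linarith), ← mul_add,
    mul_div_cancel_left₀ _ two_ne_zero]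
  have hden : 0 < 1 / 4 - ε ^ 2 := by nlinarith
  by_cases hcl : peak σ * |a| ≤ ε
  · have hq : clippedProb σ ε a = posProb σ a := by simp [clippedProb, hcl]
    rw [hq]
    have hhalf := abs_posProb_sub_le hσ 0 a
    rw [posProb_zero hσ, sub_zero] at hhalf
    have hd := abs_posProb_sub_le hσ a (a + h)
    rw [add_sub_cancel_left] at hd
    refine (binary_rpow_le hρ hρ1 hε (hhalf.trans hcl) h0 h1).trans ?_
    have hsq : (posProb σ (a + h) - posProb σ a) ^ 2 ≤ peak σ ^ 2 * h ^ 2 := by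
      rw [← sq_abs, ← sq_abs h, ← mul_pow]
      gcongr
    have hcu : |posProb σ (a + h) - posProb σ a| ^ 3 ≤ peak σ ^ 3 * |h| ^ 3 := by
      rw [← mul_pow]
      gcongr
    have h4 : 0 ≤ (peak σ / ε) ^ 4 * a ^ 4 := by positivity
    have h5 : ρ * (1 + ρ) / 2 * ((posProb σ (a + h) - posProb σ a) ^ 2 / (1 / 4 - ε ^ 2)) ≤
        ρ * (1 + ρ) / 2 * (peak σ ^ 2 * h ^ 2 / (1 / 4 - ε ^ 2)) := by gcongr
    have h6 : ρ * (1 + ρ) / 2 * (peak σ ^ 2 * h ^ 2 / (1 / 4 - ε ^ 2)) =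
        ρ * (1 + ρ) / 2 * (peak σ ^ 2 / (1 / 4 - ε ^ 2)) * h ^ 2 := by ring
    linarith
  · have hq : clippedProb σ ε a = 1 / 2 := by simp [clippedProb, hcl]
    rw [hq]
    have hhalf : (1 - 1 / 2 : ℝ) = 1 / 2 := by norm_num
    rw [hhalf, ← add_mul]
    have hle : ∀ x : ℝ, 0 < x → x < 1 → x ^ (1 + ρ) ≤ x := fun x hx hx1 => by
      simpa using Real.rpow_le_rpow_of_exponent_ge hx hx1.le (show (1 : ℝ) ≤ 1 + ρ by linarith)
    have hs : posProb σ (a + h) ^ (1 + ρ) + (1 - posProb σ (a + h)) ^ (1 + ρ) ≤ 1 := by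
      have := hle _ h0 h1
      have := hle (1 - posProb σ (a + h)) (by linarith) (by linarith)
      linarith
    have hp : (1 / 2 : ℝ) ^ (-ρ) ≤ 2 := by
      rw [one_div, Real.inv_rpow zero_le_two, Real.rpow_neg zero_le_two, inv_inv]
      simpa using Real.rpow_le_rpow_of_exponent_le one_le_two hρ1
    have hp0 : (0 : ℝ) ≤ (1 / 2 : ℝ) ^ (-ρ) := by positivity
    have hlarge : 1 ≤ (peak σ / ε) ^ 4 * a ^ 4 := by
      have h1 : 1 ≤ peak σ / ε * |a| := by
        rw [div_mul_eq_mul_div, one_le_div hε0]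
        exact (not_le.1 hcl).le
      have h2 := one_le_pow₀ h1 (n := 4)
      rwa [mul_pow, Even.pow_abs (by decide)] at h2
    have h5 : 0 ≤ ρ * (1 + ρ) / 2 * (peak σ ^ 2 / (1 / 4 - ε ^ 2)) * h ^ 2 := by positivity
    have h6 : 0 ≤ 32 * peak σ ^ 3 * |h| ^ 3 := by positivity
    nlinarith

lemma integrable_eval_abs_pow {p : ℕ} (j : Fin p) (r : ℕ) :
    Integrable (fun x : Fin p → ℝ => |x j| ^ r) (Measure.pi fun _ : Fin p => gaussianReal 0 1) :=
  (measurePreserving_eval (fun _ : Fin p => gaussianReal 0 1) j).integrable_comp_of_integrable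
    (integrable_abs_pow_gaussianReal 1 r)

lemma integral_eval_abs_pow {p : ℕ} (j : Fin p) (r : ℕ) :
    ∫ x : Fin p → ℝ, |x j| ^ r ∂(Measure.pi fun _ : Fin p => gaussianReal 0 1) = absMoment r := by
  have h := measurePreserving_eval (fun _ : Fin p => gaussianReal 0 1) j
  rw [absMoment]
  conv_rhs => rw [← h.map_eq]
  rw [integral_map h.aemeasurable (by fun_prop)]

/-- Cauchy–Schwarz twice; no independence of the summands is used. -/
lemma sum_pow_four_le {ι : Type*} [Fintype ι] (u : ι → ℝ) :
    (∑ i, u i) ^ 4 ≤ (Fintype.card ι : ℝ) ^ 3 * ∑ i, u i ^ 4 := by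
  have h1 := sq_sum_le_card_mul_sum_sq (s := Finset.univ) (f := u)
  have h2 := sq_sum_le_card_mul_sum_sq (s := Finset.univ) (f := fun i => u i ^ 2)
  rw [Finset.card_univ] at h1 h2
  have h0 : (0 : ℝ) ≤ Fintype.card ι := by positivity
  calc (∑ i, u i) ^ 4 = ((∑ i, u i) ^ 2) ^ 2 := by ring
    _ ≤ (Fintype.card ι * ∑ i, u i ^ 2) ^ 2 := by gcongr
    _ = (Fintype.card ι : ℝ) ^ 2 * (∑ i, u i ^ 2) ^ 2 := by ring
    _ ≤ (Fintype.card ι : ℝ) ^ 2 * (Fintype.card ι * ∑ i, (u i ^ 2) ^ 2) := by gcongr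
    _ = _ := by
      simp_rw [← pow_mul]
      ring

lemma lintegral_sgn_le {p k : ℕ} (i₀ : Fin k) (b : Fin k → ℝ) {σ : ℝ} (hσ : 0 < σ) {ρ ε B : ℝ}
    (hρ : 0 < ρ) (hρ1 : ρ ≤ 1) (hε0 : 0 < ε) (hε : ε ≤ 1 / 4) (hB : ∀ i, |b i| ≤ B)
    (e : Fin k ↪ Fin p) :
    ∫⁻ x, ∫⁻ y, ENNReal.ofReal (signDensity (posProb σ (∑ i, x (e i) * b i)) y ^ (1 + ρ) *
      signDensity (clippedProb σ ε (∑ i : {i // i ≠ i₀}, x (e i) * b i)) y ^ (-ρ)) ∂signLaw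
        ∂(Measure.pi fun _ : Fin p => gaussianReal 0 1) ≤
      ENNReal.ofReal (1 + ρ * (1 + ρ) / 2 * (peak σ ^ 2 / (1 / 4 - ε ^ 2)) * b i₀ ^ 2 +
        32 * peak σ ^ 3 * absMoment 3 * |b i₀| ^ 3 +
        (peak σ / ε) ^ 4 * k ^ 4 * absMoment 4 * B ^ 4) := by
  have hpk := (peak_pos hσ).le
  have hden : 0 < 1 / 4 - ε ^ 2 := by nlinarith
  set μ := Measure.pi fun _ : Fin p => gaussianReal 0 1
  set c₂ := ρ * (1 + ρ) / 2 * (peak σ ^ 2 / (1 / 4 - ε ^ 2)) with hc₂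
  set c₃ := 32 * peak σ ^ 3 with hc₃
  set c₄ := (peak σ / ε) ^ 4 with hc₄
  have hc₂0 : 0 ≤ c₂ := by positivity
  have hc₃0 : 0 ≤ c₃ := by positivity
  have hc₄0 : 0 ≤ c₄ := by positivity
  have hcard : (Fintype.card {i : Fin k // i ≠ i₀} : ℝ) ≤ k := by
    have := Fintype.card_subtype_le (fun i : Fin k => i ≠ i₀)
    rw [Fintype.card_fin] at this
    exact_mod_cast this
  set Φ : (Fin p → ℝ) → ℝ := fun x => 1 + c₂ * b i₀ ^ 2 * |x (e i₀)| ^ 2 +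
    c₃ * |b i₀| ^ 3 * |x (e i₀)| ^ 3 +
    c₄ * k ^ 3 * B ^ 4 * ∑ i : {i // i ≠ i₀}, |x (e i)| ^ 4 with hΦ
  have hint : Integrable Φ μ := by
    refine (((integrable_const _).add ((integrable_eval_abs_pow _ _).const_mul _)).add
      ((integrable_eval_abs_pow _ _).const_mul _)).add (Integrable.const_mul ?_ _)
    exact integrable_finsetSum _ fun i _ => integrable_eval_abs_pow _ _
  have hΦ0 : ∀ x, 0 ≤ Φ x := fun x => by positivity
  have hval : ∫ x, Φ x ∂μ = 1 + c₂ * b i₀ ^ 2 * 1 + c₃ * |b i₀| ^ 3 * absMoment 3 +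
      c₄ * k ^ 3 * B ^ 4 * (Fintype.card {i : Fin k // i ≠ i₀} * absMoment 4) := by
    simp only [hΦ]
    rw [integral_add, integral_add, integral_add, integral_const_mul, integral_const_mul,
      integral_const_mul, integral_finsetSum]
    · simp only [μ, integral_eval_abs_pow, absMoment_two, Finset.sum_const, Finset.card_univ,
        nsmul_eq_mul]
      simp
    · exact fun i _ => integrable_eval_abs_pow _ _
    · exact integrable_const _
    · exact (integrable_eval_abs_pow _ _).const_mul _
    · exact (integrable_const _).add ((integrable_eval_abs_pow _ _).const_mul _)
    · exact (integrable_eval_abs_pow _ _).const_mul _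
    · exact ((integrable_const _).add ((integrable_eval_abs_pow _ _).const_mul _)).add
        ((integrable_eval_abs_pow _ _).const_mul _)
    · exact (integrable_finsetSum _ fun i _ => integrable_eval_abs_pow _ _).const_mul _
  calc _ ≤ ∫⁻ x, ENNReal.ofReal (Φ x) ∂μ := by
        refine lintegral_mono fun x => ?_
        simp only []
        rw [sum_eq_rest_add i₀ b e x]
        refine (lintegral_signDensity_rpow_le hσ hρ hρ1 hε0 hε _ _).trans
          (ENNReal.ofReal_le_ofReal ?_)
        have h4 : (∑ i : {i // i ≠ i₀}, x (e i) * b i) ^ 4 ≤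
            k ^ 3 * (B ^ 4 * ∑ i : {i // i ≠ i₀}, |x (e i)| ^ 4) := by
          refine (sum_pow_four_le _).trans ?_
          have : ∑ i : {i // i ≠ i₀}, (x (e i) * b i) ^ 4 ≤
              B ^ 4 * ∑ i : {i // i ≠ i₀}, |x (e i)| ^ 4 := by
            rw [Finset.mul_sum]
            refine Finset.sum_le_sum fun i _ => ?_
            rw [mul_pow, mul_comm, Even.pow_abs (by decide)]
            refine mul_le_mul_of_nonneg_right ?_ (Even.pow_nonneg (by decide) _)
            rw [← Even.pow_abs (n := 4) (by decide) (b i)]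
            exact pow_le_pow_left₀ (abs_nonneg _) (hB i) 4
          gcongr
        have h4' := mul_le_mul_of_nonneg_left h4 hc₄0
        have h2 : (x (e i₀) * b i₀) ^ 2 = b i₀ ^ 2 * |x (e i₀)| ^ 2 := by rw [sq_abs]; ring
        have h3 : |x (e i₀) * b i₀| ^ 3 = |b i₀| ^ 3 * |x (e i₀)| ^ 3 := by rw [abs_mul]; ring
        rw [h2, h3, ← hc₂, ← hc₃, ← hc₄]
        simp only [hΦ]
        linarith
    _ = ENNReal.ofReal (∫ x, Φ x ∂μ) :=
        (ofReal_integral_eq_lintegral_ofReal hint (ae_of_all _ hΦ0)).symm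
    _ ≤ _ := by
        refine ENNReal.ofReal_le_ofReal ?_
        rw [hval]
        have h4 := absMoment_nonneg 4
        -- The power `k ^ 4` is the `k ^ 3` of the power-mean inequality times the number of
        -- summands.
        have : c₄ * k ^ 3 * B ^ 4 * (Fintype.card {i : Fin k // i ≠ i₀} * absMoment 4) ≤
            c₄ * k ^ 3 * B ^ 4 * (k * absMoment 4) := by
          have : 0 ≤ B ^ 4 := Even.pow_nonneg (by decide) _
          gcongr
        linarith

/-- The converse bound of the 1-bit model. -/
lemma one_sub_errorProb_sgn_le {p k n : ℕ} (hkp : k ≤ p) (i₀ : Fin k) (b : Fin k → ℝ) {σ : ℝ}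
    (hσ : 0 < σ) (dec : Decoder p n) {c ρ ε B : ℝ} (hc : 0 < c) (hρ : 0 < ρ) (hρ1 : ρ ≤ 1)
    (hε0 : 0 < ε) (hε : ε ≤ 1 / 4) (hB : ∀ i, |b i| ≤ B) :
    1 - errorProb sgn σ b dec ≤ c / ((p : ℝ) - k + 1) + c ^ (-ρ) *
      (1 + ρ * (1 + ρ) / 2 * (peak σ ^ 2 / (1 / 4 - ε ^ 2)) * b i₀ ^ 2 +
        32 * peak σ ^ 3 * absMoment 3 * |b i₀| ^ 3 +
        (peak σ / ε) ^ 4 * k ^ 4 * absMoment 4 * B ^ 4) ^ n := by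
  have hpk := (peak_pos hσ).le
  have hden : 0 < 1 / 4 - ε ^ 2 := by nlinarith
  have h3 := absMoment_nonneg 3
  have h4 := absMoment_nonneg 4
  exact one_sub_errorProb_le hkp i₀ (fQ := fun t y => signDensity (clippedProb σ ε t) y)
    measurable_sgn (isChannelDensity_sgn hσ)
    (measurable_signDensity (measurable_clippedProb σ ε))
    (fun t y => signDensity_pos (clippedProb_pos hσ ε t) (clippedProb_lt_one hσ ε t) y)
    (fun t => lintegral_signDensity (clippedProb_pos hσ ε t) (clippedProb_lt_one hσ ε t)) b dec
    hc hρ (by positivity) (lintegral_sgn_le i₀ b hσ hρ hρ1 hε0 hε hB)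

/-! ### Joint law of a column entry and of an unquantized observation -/

/-- The unquantized observation. -/
def rowSum {p : ℕ} (β : Fin p → ℝ) (ω : (Fin p → ℝ) × ℝ) : ℝ := (∑ j, ω.1 j * β j) + ω.2

@[fun_prop]
lemma measurable_rowSum {p : ℕ} (β : Fin p → ℝ) : Measurable (rowSum β) := by
  unfold rowSum
  fun_prop

/-- The variance of the unquantized observation. -/
def rowVar {p : ℕ} (σ : ℝ) (β : Fin p → ℝ) : ℝ := σ ^ 2 + ∑ j, β j ^ 2

lemma rowVar_pos {p : ℕ} {σ : ℝ} (hσ : 0 < σ) (β : Fin p → ℝ) : 0 < rowVar σ β :=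
  add_pos_of_pos_of_nonneg (by positivity) (Finset.sum_nonneg fun _ _ => sq_nonneg _)

instance (p : ℕ) : IsGaussian (Measure.pi fun _ : Fin p => gaussianReal 0 1) := by
  have hind := iIndepFun_pi (μ := fun _ : Fin p => gaussianReal 0 1) (X := fun _ x => x)
    fun _ => aemeasurable_id
  have h : HasGaussianLaw (fun ω : Fin p → ℝ => fun i => ω i)
      (Measure.pi fun _ : Fin p => gaussianReal 0 1) := by
    refine hind.hasGaussianLaw fun i => ⟨?_⟩
    have := (measurePreserving_eval (fun _ : Fin p => gaussianReal 0 1) i).map_eq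
    rw [show (fun ω : Fin p → ℝ => ω i) = Function.eval i from rfl, this]
    infer_instance
  have h' := h.isGaussian_map
  rwa [show (fun ω : Fin p → ℝ => fun i => ω i) = id from rfl, Measure.map_id] at h'

instance (p : ℕ) (σ : ℝ) : IsGaussian (rowLaw p σ) := by
  unfold rowLaw; infer_instance

lemma measurePreserving_rowLaw_eval {p : ℕ} (σ : ℝ) (j : Fin p) :
    MeasurePreserving (fun ω : (Fin p → ℝ) × ℝ => ω.1 j) (rowLaw p σ) (gaussianReal 0 1) :=
  (measurePreserving_eval (fun _ : Fin p => gaussianReal 0 1) j).comp measurePreserving_fst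

lemma measurePreserving_rowLaw_snd (p : ℕ) (σ : ℝ) :
    MeasurePreserving (fun ω : (Fin p → ℝ) × ℝ => ω.2) (rowLaw p σ)
      (gaussianReal 0 (Real.toNNReal (σ ^ 2))) :=
  measurePreserving_snd

lemma memLp_rowLaw_eval {p : ℕ} (σ : ℝ) (j : Fin p) (r : ℝ≥0∞) (hr : r ≠ ∞) :
    MemLp (fun ω : (Fin p → ℝ) × ℝ => ω.1 j) r (rowLaw p σ) :=
  (memLp_id_gaussianReal' r hr).comp_measurePreserving (measurePreserving_rowLaw_eval σ j)

lemma memLp_rowLaw_snd (p : ℕ) (σ : ℝ) (r : ℝ≥0∞) (hr : r ≠ ∞) :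
    MemLp (fun ω : (Fin p → ℝ) × ℝ => ω.2) r (rowLaw p σ) :=
  (memLp_id_gaussianReal' r hr).comp_measurePreserving (measurePreserving_rowLaw_snd p σ)

lemma MeasurePreserving.integral_comp_real {Ω : Type*} [MeasurableSpace Ω] {μ : Measure Ω}
    {ν : Measure ℝ} {X : Ω → ℝ} (h : MeasurePreserving X μ ν) {F : ℝ → ℝ} (hF : Measurable F) :
    ∫ ω, F (X ω) ∂μ = ∫ x, F x ∂ν := by
  rw [← h.map_eq, integral_map h.aemeasurable hF.aestronglyMeasurable]

lemma integral_rowLaw_eval {p : ℕ} (σ : ℝ) (j : Fin p) : ∫ ω, ω.1 j ∂(rowLaw p σ) = 0 := by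
  have := MeasurePreserving.integral_comp_real (measurePreserving_rowLaw_eval σ j) measurable_id
  simpa using this

lemma integral_rowLaw_snd (p : ℕ) (σ : ℝ) : ∫ ω, ω.2 ∂(rowLaw p σ) = 0 := by
  have := MeasurePreserving.integral_comp_real (measurePreserving_rowLaw_snd p σ) measurable_id
  simpa using this

lemma memLp_rowSum {p : ℕ} (σ : ℝ) (β : Fin p → ℝ) (r : ℝ≥0∞) (hr : r ≠ ∞) :
    MemLp (rowSum β) r (rowLaw p σ) :=
  (memLp_finsetSum _ fun j _ => (memLp_rowLaw_eval σ j r hr).mul_const (β j)).add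
    (memLp_rowLaw_snd p σ r hr)

lemma integral_rowSum {p : ℕ} (σ : ℝ) (β : Fin p → ℝ) : ∫ ω, rowSum β ω ∂(rowLaw p σ) = 0 := by
  have hX : ∀ j : Fin p, Integrable (fun ω : (Fin p → ℝ) × ℝ => ω.1 j * β j) (rowLaw p σ) :=
    fun j => ((memLp_rowLaw_eval σ j 1 (by simp)).integrable le_rfl).mul_const _
  unfold rowSum
  rw [integral_add (integrable_finsetSum _ fun j _ => hX j)
    ((memLp_rowLaw_snd p σ 1 (by simp)).integrable le_rfl),
    integral_finsetSum _ fun j _ => hX j, integral_rowLaw_snd]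
  simp [integral_mul_const, integral_rowLaw_eval]

lemma covariance_rowLaw_eval {p : ℕ} (σ : ℝ) (i j : Fin p) :
    cov[fun ω => ω.1 i, fun ω => ω.1 j; rowLaw p σ] = if i = j then 1 else 0 := by
  split_ifs with h
  · subst h
    rw [covariance_self (by fun_prop),
      variance_of_integral_eq_zero (by fun_prop) (integral_rowLaw_eval σ i),
      MeasurePreserving.integral_comp_real (measurePreserving_rowLaw_eval σ i)
        (F := fun x => x ^ 2) (by fun_prop)]
    have := absMoment_two
    simpa [absMoment] using this
  · have hind := (iIndepFun_pi (μ := fun _ : Fin p => gaussianReal 0 1) (X := fun _ x => x)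
      fun _ => aemeasurable_id).indepFun h
    have hL : ∀ i : Fin p, MemLp (fun x : Fin p → ℝ => x i) 2
        (Measure.pi fun _ : Fin p => gaussianReal 0 1) := fun i =>
      (memLp_id_gaussianReal' 2 (by simp)).comp_measurePreserving
        (measurePreserving_eval (fun _ : Fin p => gaussianReal 0 1) i)
    have h0 := hind.covariance_eq_zero (hL i) (hL j)
    have hmap : (rowLaw p σ).map Prod.fst = Measure.pi fun _ : Fin p => gaussianReal 0 1 :=
      measurePreserving_fst.map_eq
    rw [← hmap, covariance_map_fun (measurable_pi_apply i).aestronglyMeasurable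
      (measurable_pi_apply j).aestronglyMeasurable (by fun_prop)] at h0
    exact h0

lemma covariance_rowLaw_eval_snd {p : ℕ} (σ : ℝ) (j : Fin p) :
    cov[fun ω => ω.1 j, fun ω => ω.2; rowLaw p σ] = 0 :=
  covariance_fst_snd_prod (X := fun x : Fin p → ℝ => x j) (Y := fun z => z)
    ((memLp_id_gaussianReal' 2 (by simp)).comp_measurePreserving
      (measurePreserving_eval (fun _ : Fin p => gaussianReal 0 1) j))
    (memLp_id_gaussianReal' 2 (by simp))

lemma covariance_eval_rowSum {p : ℕ} (σ : ℝ) (β : Fin p → ℝ) (j : Fin p) :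
    cov[fun ω => ω.1 j, rowSum β; rowLaw p σ] = β j := by
  have hX := fun i : Fin p => memLp_rowLaw_eval σ i 2 (by simp)
  have hZ := memLp_rowLaw_snd p σ 2 (by simp)
  have e : rowSum β = (fun ω : (Fin p → ℝ) × ℝ => ∑ i, ω.1 i * β i) + fun ω => ω.2 := rfl
  rw [e, covariance_add_right (hX j) (memLp_finsetSum _ fun i _ => (hX i).mul_const (β i)) hZ,
    covariance_rowLaw_eval_snd, covariance_fun_sum_right (fun i => (hX i).mul_const (β i)) (hX j)]
  simp [covariance_mul_const_right, covariance_rowLaw_eval]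

lemma covariance_rowSum_self {p : ℕ} (σ : ℝ) (β : Fin p → ℝ) :
    cov[rowSum β, rowSum β; rowLaw p σ] = rowVar σ β := by
  have hX := fun i : Fin p => memLp_rowLaw_eval σ i 2 (by simp)
  have hZ := memLp_rowLaw_snd p σ 2 (by simp)
  have hS : MemLp (fun ω : (Fin p → ℝ) × ℝ => ∑ i, ω.1 i * β i) 2 (rowLaw p σ) :=
    memLp_finsetSum _ fun i _ => (hX i).mul_const (β i)
  have hW := memLp_rowSum σ β 2 (by simp)
  have hZZ : cov[fun ω => ω.2, fun ω => ω.2; rowLaw p σ] = σ ^ 2 := by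
    rw [covariance_self (by fun_prop)]
    have := variance_fun_id_gaussianReal (μ := 0) (v := Real.toNNReal (σ ^ 2))
    rw [← (measurePreserving_rowLaw_snd p σ).map_eq, variance_map (by fun_prop) (by fun_prop),
      coe_toNNReal_sq] at this
    exact this
  have hZW : cov[fun ω => ω.2, rowSum β; rowLaw p σ] = σ ^ 2 := by
    have e : rowSum β = (fun ω : (Fin p → ℝ) × ℝ => ∑ i, ω.1 i * β i) + fun ω => ω.2 := rfl
    rw [e, covariance_add_right hZ hS hZ, hZZ,
      covariance_fun_sum_right (fun i => (hX i).mul_const (β i)) hZ]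
    simp only [covariance_mul_const_right]
    simp [covariance_comm (X := fun ω : (Fin p → ℝ) × ℝ => ω.2), covariance_rowLaw_eval_snd]
  have e : cov[rowSum β, rowSum β; rowLaw p σ] =
      cov[(fun ω : (Fin p → ℝ) × ℝ => ∑ i, ω.1 i * β i) + fun ω => ω.2, rowSum β;
        rowLaw p σ] := rfl
  rw [e, covariance_add_left hS hZ hW, hZW,
    covariance_fun_sum_left (fun i => (hX i).mul_const (β i)) hW]
  simp only [covariance_mul_const_left, covariance_eval_rowSum]
  rw [rowVar, add_comm]
  simp [sq]

lemma hasGaussianLaw_rowSum_pair {p : ℕ} (σ : ℝ) (β : Fin p → ℝ) (j : Fin p) (c : ℝ) :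
    HasGaussianLaw (fun ω : (Fin p → ℝ) × ℝ => (ω.1 j - c * rowSum β ω, rowSum β ω))
      (rowLaw p σ) := by
  let Xj : ((Fin p → ℝ) × ℝ) →L[ℝ] ℝ :=
    (ContinuousLinearMap.proj j).comp (ContinuousLinearMap.fst ℝ (Fin p → ℝ) ℝ)
  let W : ((Fin p → ℝ) × ℝ) →L[ℝ] ℝ :=
    (∑ i, (β i) • (ContinuousLinearMap.proj i).comp (ContinuousLinearMap.fst ℝ (Fin p → ℝ) ℝ)) +
      ContinuousLinearMap.snd ℝ (Fin p → ℝ) ℝ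
  have hid : HasGaussianLaw (fun ω : (Fin p → ℝ) × ℝ => ω) (rowLaw p σ) :=
    IsGaussian.hasGaussianLaw_id
  have h := hid.map_fun ((Xj - c • W).prod W)
  have hW : ∀ ω, W ω = rowSum β ω := fun ω => by simp [W, rowSum, mul_comm]
  have e : (fun ω : (Fin p → ℝ) × ℝ => (ω.1 j - c * rowSum β ω, rowSum β ω)) =
      fun ω => ((Xj - c • W).prod W) ω := by
    ext1 ω
    simp [Xj, hW]
  rw [e]
  exact h

lemma map_rowSum {p : ℕ} (σ : ℝ) (β : Fin p → ℝ) :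
    (rowLaw p σ).map (rowSum β) = gaussianReal 0 (Real.toNNReal (rowVar σ β)) := by
  rcases Nat.eq_zero_or_pos p with rfl | hp
  -- The general case reads the law off a Gaussian pair built with some column; without columns only
  -- the noise is left.
  · have e : rowSum β = fun ω => ω.2 := by ext ω; simp [rowSum]
    have e' : rowVar σ β = σ ^ 2 := by simp [rowVar]
    rw [e, e', (measurePreserving_rowLaw_snd 0 σ).map_eq]
  · have h := (hasGaussianLaw_rowSum_pair σ β ⟨0, hp⟩ 0).snd.map_eq_gaussianReal
    rw [integral_rowSum, ← covariance_self (by fun_prop), covariance_rowSum_self] at h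
    exact h

lemma measurePreserving_rowSum {p : ℕ} (σ : ℝ) (β : Fin p → ℝ) :
    MeasurePreserving (rowSum β) (rowLaw p σ) (gaussianReal 0 (Real.toNNReal (rowVar σ β))) :=
  ⟨measurable_rowSum β, map_rowSum σ β⟩

/-- The residual of the linear regression of a column on the unquantized observation is uncorrelated
with it, and the pair is jointly Gaussian. This reduces every correlation with a quantized
observation to a one-dimensional integral. -/
lemma indepFun_residual {p : ℕ} {σ : ℝ} (hσ : 0 < σ) (β : Fin p → ℝ) (j : Fin p) :
    IndepFun (fun ω : (Fin p → ℝ) × ℝ => ω.1 j - β j / rowVar σ β * rowSum β ω) (rowSum β)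
      (rowLaw p σ) := by
  refine (hasGaussianLaw_rowSum_pair σ β j _).indepFun_of_covariance_eq_zero ?_
  have hW := memLp_rowSum σ β 2 (by simp)
  rw [covariance_fun_sub_left (memLp_rowLaw_eval σ j 2 (by simp)) (hW.const_mul _) hW,
    covariance_const_mul_left, covariance_eval_rowSum, covariance_rowSum_self,
    div_mul_cancel₀ _ (rowVar_pos hσ β).ne', sub_self]

/-- The correlation of a column entry with a function of the unquantized observation. -/
lemma integral_eval_mul_rowSum {p : ℕ} {σ : ℝ} (hσ : 0 < σ) (β : Fin p → ℝ) (j : Fin p)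
    {g : ℝ → ℝ} (hg : Measurable g)
    (hg2 : MemLp g 2 (gaussianReal 0 (Real.toNNReal (rowVar σ β)))) :
    ∫ ω, ω.1 j * g (rowSum β ω) ∂(rowLaw p σ) =
      β j / rowVar σ β * ∫ w, w * g w ∂(gaussianReal 0 (Real.toNNReal (rowVar σ β))) := by
  have hW := memLp_rowSum σ β 2 (by simp)
  have hX := memLp_rowLaw_eval σ j 2 (by simp)
  have hgW : MemLp (fun ω => g (rowSum β ω)) 2 (rowLaw p σ) :=
    hg2.comp_measurePreserving (measurePreserving_rowSum σ β)
  have hind := (indepFun_residual hσ β j).comp measurable_id hg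
  have h0 : ∫ ω : (Fin p → ℝ) × ℝ, ω.1 j - β j / rowVar σ β * rowSum β ω ∂(rowLaw p σ) = 0 := by
    rw [integral_sub (hX.integrable one_le_two) ((hW.integrable one_le_two).const_mul _),
      integral_const_mul, integral_rowSum, integral_rowLaw_eval]
    simp
  have h1 := hind.integral_fun_mul_eq_mul_integral (by fun_prop)
    (hg.comp (measurable_rowSum β)).aestronglyMeasurable
  have i1 : Integrable (fun ω : (Fin p → ℝ) × ℝ => ω.1 j * g (rowSum β ω)) (rowLaw p σ) :=
    hX.integrable_mul hgW
  have i2 : Integrable (fun ω : (Fin p → ℝ) × ℝ => β j / rowVar σ β *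
      (rowSum β ω * g (rowSum β ω))) (rowLaw p σ) := (hW.integrable_mul hgW).const_mul _
  simp only [Function.comp_apply, id, h0, zero_mul] at h1
  rw [← MeasurePreserving.integral_comp_real (measurePreserving_rowSum σ β)
    (F := fun w => w * g w) (by fun_prop), ← integral_const_mul, ← sub_eq_zero, ← integral_sub
    i1 i2, ← h1]
  congr 1
  ext ω
  ring

/-- The moment generating function of the correlation of an irrelevant column. -/
lemma lintegral_exp_eval_mul_rowSum {p : ℕ} {σ : ℝ} (hσ : 0 < σ) {β : Fin p → ℝ} {j : Fin p}
    (hj : β j = 0) {g : ℝ → ℝ} (hg : Measurable g) (s : ℝ) :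
    ∫⁻ ω, ENNReal.ofReal (Real.exp (s * (ω.1 j * g (rowSum β ω)))) ∂(rowLaw p σ) =
      ∫⁻ w, ENNReal.ofReal (Real.exp (s ^ 2 / 2 * g w ^ 2))
        ∂(gaussianReal 0 (Real.toNNReal (rowVar σ β))) := by
  have hind := indepFun_residual hσ β j
  simp only [hj, zero_div, zero_mul, sub_zero] at hind
  have hmap := (indepFun_iff_map_prod_eq_prod_map_map (by fun_prop) (by fun_prop)).1 hind
  rw [map_rowSum, (measurePreserving_rowLaw_eval σ j).map_eq] at hmap
  have hF : Measurable fun z : ℝ × ℝ => ENNReal.ofReal (Real.exp (s * (z.1 * g z.2))) := by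
    fun_prop
  have h1 := lintegral_map (μ := rowLaw p σ) hF
    (g := fun ω : (Fin p → ℝ) × ℝ => (ω.1 j, rowSum β ω)) (by fun_prop)
  -- The column is integrated first, with the observation held fixed; this is a Gaussian moment
  -- generating function.
  rw [← h1, hmap, lintegral_prod_symm _ hF.aemeasurable]
  refine lintegral_congr fun w => ?_
  have e : ∀ x, s * (x * g w) = s * g w * x := fun x => by ring
  simp_rw [e]
  rw [← ofReal_integral_eq_lintegral_ofReal (integrable_exp_mul_gaussianReal _)
    (ae_of_all _ fun _ => by positivity)]
  have := congrFun (mgf_fun_id_gaussianReal (μ := 0) (v := 1)) (s * g w)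
  rw [mgf] at this
  rw [this]
  congr 2
  push_cast
  ring

/-! ### The correlation threshold decoder -/

/-- The decoder that returns the columns whose correlation with the observations exceeds `t`. -/
def thresholdDecoder (p n : ℕ) (t : ℝ) : Decoder p n where
  est X Y := Finset.univ.filter fun j => t < |∑ i, X i j * Y i|
  measurableSet_est T := by
    have hj : ∀ j : Fin p, MeasurableSet
        {q : (Fin n → Fin p → ℝ) × (Fin n → ℝ) | t < |∑ i, q.1 i j * q.2 i|} := fun j =>
      measurableSet_lt measurable_const (by fun_prop)
    have e : {q : (Fin n → Fin p → ℝ) × (Fin n → ℝ) |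
        (Finset.univ.filter fun j => t < |∑ i, q.1 i j * q.2 i|) = T} =
        ⋂ j : Fin p, {q | t < |∑ i, q.1 i j * q.2 i| ↔ j ∈ T} := by
      ext q
      simp [Finset.ext_iff]
    rw [e]
    refine MeasurableSet.iInter fun j => ?_
    by_cases h : j ∈ T
    · simpa [h] using hj j
    · simp only [h, iff_false]
      exact (hj j).compl

/-- The Chernoff bound; a negative `s` covers the lower tail. -/
lemma pi_real_le_exp {Ω : Type*} [MeasurableSpace Ω] {n : ℕ} (m : Measure Ω)
    [IsProbabilityMeasure m] {ξ : Ω → ℝ} (hξ : Measurable ξ) {s κ t : ℝ}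
    (h : ∫⁻ ω, ENNReal.ofReal (Real.exp (s * ξ ω)) ∂m ≤ ENNReal.ofReal (Real.exp κ)) :
    (Measure.pi fun _ : Fin n => m).real {q | t ≤ s * ∑ i, ξ (q i)} ≤ Real.exp (n * κ - t) := by
  refine ENNReal.toReal_le_of_le_ofReal (Real.exp_pos _).le ?_
  have hF : Measurable fun ω => ENNReal.ofReal (Real.exp (s * ξ ω)) := by fun_prop
  have hm := mul_meas_ge_le_lintegral (μ := Measure.pi fun _ : Fin n => m)
    (f := fun q => ∏ i, ENNReal.ofReal (Real.exp (s * ξ (q i)))) (by fun_prop)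
    (ENNReal.ofReal (Real.exp t))
  rw [lintegral_pi_prod m fun _ : Fin n => hF, Finset.prod_const, Finset.card_univ,
    Fintype.card_fin] at hm
  have hset : {q : Fin n → Ω | t ≤ s * ∑ i, ξ (q i)} =
      {q | ENNReal.ofReal (Real.exp t) ≤ ∏ i, ENNReal.ofReal (Real.exp (s * ξ (q i)))} := by
    ext q
    simp only [Set.mem_ofPred_eq]
    rw [← ENNReal.ofReal_prod_of_nonneg fun i _ => (Real.exp_pos _).le, ← Real.exp_sum,
      ENNReal.ofReal_le_ofReal_iff (Real.exp_pos _).le, Real.exp_le_exp, Finset.mul_sum]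
  have hle := hm.trans (pow_le_pow_left' h n)
  rw [← ENNReal.ofReal_pow (Real.exp_pos _).le, ← Real.exp_nat_mul] at hle
  rw [hset, Real.exp_sub, ENNReal.ofReal_div_of_pos (Real.exp_pos _)]
  rw [ENNReal.le_div_iff_mul_le (Or.inl (by simp [Real.exp_pos])) (Or.inl ENNReal.ofReal_ne_top),
    mul_comm]
  exact hle

/-- Chebyshev's inequality: a sum of modulus at most `t` is at distance at least `n * s - t` from
its mean. -/
lemma pi_real_abs_sum_le {Ω : Type*} [MeasurableSpace Ω] {n : ℕ} (m : Measure Ω)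
    [IsProbabilityMeasure m] {ξ : Ω → ℝ} (hξ : MemLp ξ 2 m) {D s t : ℝ}
    (hD : ∫ ω, ξ ω ^ 2 ∂m ≤ D) (hs : s ≤ |∫ ω, ξ ω ∂m|) (ht : t < n * s) :
    (Measure.pi fun _ : Fin n => m).real {q | |∑ i, ξ (q i)| ≤ t} ≤ n * D / (n * s - t) ^ 2 := by
  have hmp := fun i : Fin n => measurePreserving_eval (fun _ : Fin n => m) i
  have hξi : ∀ i : Fin n, MemLp (fun q : Fin n → Ω => ξ (q i)) 2 (Measure.pi fun _ : Fin n => m) :=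
    fun i => hξ.comp_measurePreserving (hmp i)
  have hS : MemLp (fun q : Fin n → Ω => ∑ i, ξ (q i)) 2 (Measure.pi fun _ : Fin n => m) :=
    memLp_finsetSum _ fun i _ => hξi i
  have hmean : ∫ q, ∑ i, ξ (q i) ∂(Measure.pi fun _ : Fin n => m) = n * ∫ ω, ξ ω ∂m := by
    rw [integral_finsetSum _ fun i _ => (hξi i).integrable one_le_two]
    have : ∀ i : Fin n, ∫ q, ξ (q i) ∂(Measure.pi fun _ : Fin n => m) = ∫ ω, ξ ω ∂m := by
      intro i
      have h1 := hξ.aestronglyMeasurable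
      rw [← (hmp i).map_eq] at h1
      have h2 := integral_map (hmp i).aemeasurable h1
      rw [(hmp i).map_eq] at h2
      exact h2.symm
    simp [this]
  have hvar : Var[fun q : Fin n → Ω => ∑ i, ξ (q i); Measure.pi fun _ : Fin n => m] ≤ n * D := by
    have h1 := variance_sum_pi (μ := fun _ : Fin n => m) (X := fun _ => ξ) fun _ => hξ
    have h2 : (∑ i : Fin n, fun q : Fin n → Ω => ξ (q i)) = fun q => ∑ i, ξ (q i) := by
      ext q; simp
    rw [h2] at h1
    rw [h1, Finset.sum_const, Finset.card_univ, Fintype.card_fin, nsmul_eq_mul]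
    gcongr
    refine (variance_le_expectation_sq hξ.aestronglyMeasurable).trans ?_
    simpa using hD
  have hpos : 0 < n * s - t := by linarith
  have hcheb := meas_ge_le_variance_div_sq hS hpos
  refine ENNReal.toReal_le_of_le_ofReal ?_ ((measure_mono ?_).trans (hcheb.trans
    (ENNReal.ofReal_le_ofReal (by gcongr))))
  · exact div_nonneg ((variance_nonneg _ _).trans hvar) (sq_nonneg _)
  · intro q hq
    simp only [Set.mem_ofPred_eq] at hq ⊢
    rw [hmean]
    have h1 : (n : ℝ) * s ≤ |n * ∫ ω, ξ ω ∂m| := by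
      rw [abs_mul, Nat.abs_cast]
      gcongr
    have h2 := abs_sub_abs_le_abs_sub (n * ∫ ω, ξ ω ∂m) (∑ i, ξ (q i))
    rw [abs_sub_comm] at h2
    linarith

/-- Union bound: a false alarm on one of at most `p` null columns, two tails each, or a miss on one
of the `k` relevant ones. A polynomial bound is enough for the misses because `k` stays bounded. -/
lemma errorProb_thresholdDecoder_le {p k n : ℕ} {g : ℝ → ℝ} (hg : Measurable g) (σ : ℝ)
    (b : Fin k → ℝ) {l κ D s t : ℝ} (hl : 0 < l)
    (hnull : ∀ (e : Fin k ↪ Fin p) (j : Fin p), j ∉ Set.range e → ∀ r : ℝ, r = l ∨ r = -l →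
      ∫⁻ ω, ENNReal.ofReal (Real.exp (r * (ω.1 j * g (rowSum (embSignal b e) ω)))) ∂(rowLaw p σ) ≤
        ENNReal.ofReal (Real.exp κ))
    (hL2 : ∀ (e : Fin k ↪ Fin p) (j : Fin p),
      MemLp (fun ω => ω.1 j * g (rowSum (embSignal b e) ω)) 2 (rowLaw p σ))
    (hD : ∀ (e : Fin k ↪ Fin p) (j : Fin p),
      ∫ ω, (ω.1 j * g (rowSum (embSignal b e) ω)) ^ 2 ∂(rowLaw p σ) ≤ D)
    (hs : ∀ (e : Fin k ↪ Fin p) (i : Fin k),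
      s ≤ |∫ ω, ω.1 (e i) * g (rowSum (embSignal b e) ω) ∂(rowLaw p σ)|)
    (ht : t < n * s) (hD0 : 0 ≤ D) :
    errorProb g σ b (thresholdDecoder p n t) ≤
      2 * p * Real.exp (n * κ - l * t) + k * (n * D / (n * s - t) ^ 2) := by
  refine errorProb_le_of_forall g σ b _ (by positivity) fun e => ?_
  set ξ : Fin p → (Fin p → ℝ) × ℝ → ℝ := fun j ω => ω.1 j * g (rowSum (embSignal b e) ω) with hξ
  have hξm : ∀ j, Measurable (ξ j) := fun j => by
    simp only [hξ]
    fun_prop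
  set μ := Measure.pi fun _ : Fin n => rowLaw p σ with hμ
  have h1 : (designNoise p n σ).real {ω | (thresholdDecoder p n t).est ω.1
      (observe g (embSignal b e) ω.1 ω.2) ≠ Finset.univ.map e} =
      μ.real {q | (Finset.univ.filter fun j => t < |∑ i, ξ j (q i)|) ≠ Finset.univ.map e} := by
    rw [measureReal_def, measureReal_def, designNoise_apply]
    · rfl
    · exact measurable_observe hg (embSignal b e)
        ((thresholdDecoder p n t).measurableSet_ne (Finset.univ.map e))
  have hsub : {q : Fin n → (Fin p → ℝ) × ℝ |
      (Finset.univ.filter fun j => t < |∑ i, ξ j (q i)|) ≠ Finset.univ.map e} ⊆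
      (⋃ j ∈ Finset.univ.filter (fun j => j ∉ Set.range e),
        ({q | l * t ≤ l * ∑ i, ξ j (q i)} ∪ {q | l * t ≤ (-l) * ∑ i, ξ j (q i)})) ∪
      (⋃ i ∈ (Finset.univ : Finset (Fin k)), {q | |∑ r, ξ (e i) (q r)| ≤ t}) := by
    intro q hq
    by_contra hcon
    simp only [Set.mem_union, Set.mem_iUnion, not_or, not_exists, Finset.mem_filter,
      Finset.mem_univ, true_and, Set.mem_ofPred_eq, not_le, forall_true_left] at hcon
    refine hq ?_
    ext j
    simp only [Finset.mem_filter, Finset.mem_univ, true_and, Finset.mem_map]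
    constructor
    · intro hj
      by_contra hne
      obtain ⟨ha, hb⟩ := hcon.1 j (by rintro ⟨i, hi⟩; exact hne ⟨i, hi⟩)
      have ha' := lt_of_mul_lt_mul_left ha hl.le
      have hb' : -(∑ i, ξ j (q i)) < t := by
        refine lt_of_mul_lt_mul_left (a := l) ?_ hl.le
        linarith
      exact absurd (abs_lt.2 ⟨by linarith, ha'⟩) (not_lt.2 hj.le)
    · rintro ⟨i, rfl⟩
      exact hcon.2 i
  rw [h1]
  refine (measureReal_mono hsub).trans ((measureReal_union_le _ _).trans (add_le_add ?_ ?_))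
  · refine (measureReal_biUnion_finset_le _ _).trans ?_
    calc _ ≤ ∑ j ∈ Finset.univ.filter (fun j => j ∉ Set.range e),
          2 * Real.exp (n * κ - l * t) := by
          refine Finset.sum_le_sum fun j hj => (measureReal_union_le _ _).trans ?_
          have hj' := (Finset.mem_filter.1 hj).2
          have ha := pi_real_le_exp (n := n) (t := l * t) _ (hξm j)
            (hnull e j hj' l (Or.inl rfl))
          have hb := pi_real_le_exp (n := n) (t := l * t) _ (hξm j)
            (hnull e j hj' (-l) (Or.inr rfl))
          linarith
      _ ≤ _ := by
          rw [Finset.sum_const, nsmul_eq_mul]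
          have hc : ((Finset.univ.filter (fun j => j ∉ Set.range e)).card : ℝ) ≤ p := by
            have := Finset.card_filter_le (Finset.univ : Finset (Fin p)) (fun j => j ∉ Set.range e)
            rw [Finset.card_univ, Fintype.card_fin] at this
            exact_mod_cast this
          have := mul_le_mul_of_nonneg_right hc (Real.exp_pos (n * κ - l * t)).le
          linarith
  · refine (measureReal_biUnion_finset_le _ _).trans ?_
    calc _ ≤ ∑ _i : Fin k, (n * D / (n * s - t) ^ 2) :=
          Finset.sum_le_sum fun i _ => pi_real_abs_sum_le _ (hL2 e (e i)) (hD e (e i)) (hs e i) ht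
      _ = _ := by simp

/-! ### Correlation moments and the error of the threshold decoder in each model -/

lemma embSignal_apply {p k : ℕ} (b : Fin k → ℝ) (e : Fin k ↪ Fin p) (i : Fin k) :
    embSignal b e (e i) = b i := by
  rw [embSignal, e.injective.extend_apply]

lemma embSignal_of_notMem {p k : ℕ} (b : Fin k → ℝ) (e : Fin k ↪ Fin p) {j : Fin p}
    (hj : j ∉ Set.range e) : embSignal b e j = 0 := by
  rw [embSignal, Function.extend_apply' _ _ _ hj]
  rfl

/-- The variance of the unquantized observations. -/
def obsVar {k : ℕ} (σ : ℝ) (b : Fin k → ℝ) : ℝ := σ ^ 2 + ∑ i, b i ^ 2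

lemma obsVar_pos {k : ℕ} {σ : ℝ} (hσ : 0 < σ) (b : Fin k → ℝ) : 0 < obsVar σ b :=
  add_pos_of_pos_of_nonneg (by positivity) (Finset.sum_nonneg fun _ _ => sq_nonneg _)

lemma rowVar_embSignal {p k : ℕ} (σ : ℝ) (b : Fin k → ℝ) (e : Fin k ↪ Fin p) :
    rowVar σ (embSignal b e) = obsVar σ b := by
  have := sum_mul_embSignal b e (embSignal b e)
  simp only [embSignal_apply] at this
  rw [rowVar, obsVar]
  simp only [sq] at this ⊢
  rw [this]

lemma bMin_le {k : ℕ} (b : Fin k → ℝ) (i : Fin k) : bMin b ≤ |b i| :=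
  ciInf_le (Set.finite_range _).bddBelow i

lemma le_bMax {k : ℕ} (b : Fin k → ℝ) (i : Fin k) : |b i| ≤ bMax b :=
  le_ciSup (f := fun i => |b i|) (Set.finite_range _).bddAbove i

lemma exists_bMin_eq {k : ℕ} (hk : 0 < k) (b : Fin k → ℝ) : ∃ i, |b i| = bMin b := by
  have : Nonempty (Fin k) := ⟨⟨0, hk⟩⟩
  exact exists_eq_ciInf_of_finite (f := fun i => |b i|)

lemma map_mul_gaussianReal_one {v : ℝ} (hv : 0 ≤ v) :
    (gaussianReal 0 1).map (fun x => √v * x) = gaussianReal 0 (Real.toNNReal v) := by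
  rw [gaussianReal_map_const_mul]
  congr 1
  · simp
  · ext
    simp [Real.sq_sqrt hv, Real.coe_toNNReal v hv]

lemma integral_abs_pow_gaussianReal {v : ℝ} (hv : 0 ≤ v) (r : ℕ) :
    ∫ x, |x| ^ r ∂(gaussianReal 0 (Real.toNNReal v)) = √v ^ r * absMoment r := by
  rw [← map_mul_gaussianReal_one hv, integral_map (by fun_prop) (by fun_prop), absMoment,
    ← integral_const_mul]
  simp [abs_mul, mul_pow, abs_of_nonneg (Real.sqrt_nonneg v)]

lemma absMoment_one : absMoment 1 = √(2 / Real.pi) := by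
  have hpi := Real.pi_pos
  have h := integral_rpow_mul_exp_neg_mul_rpow (p := 2) (q := 1) (b := 1 / 2) (by norm_num)
    (by norm_num) (by norm_num)
  rw [show ((1 : ℝ) + 1) / 2 = 1 by norm_num, show -((1 : ℝ) + 1) / 2 = -1 by norm_num,
    Real.Gamma_one, Real.rpow_neg_one] at h
  have e : ∀ x : ℝ, gaussianPDFReal 0 1 x • |x| ^ 1 =
      (√(2 * Real.pi))⁻¹ * (|x| ^ (1 : ℝ) * Real.exp (-(1 / 2) * |x| ^ (2 : ℝ))) := by
    intro x
    simp only [gaussianPDFReal, smul_eq_mul, pow_one, Real.rpow_one, Real.rpow_two, sq_abs,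
      NNReal.coe_one, mul_one, sub_zero]
    rw [mul_assoc, mul_comm (Real.exp _)]
    congr 3
    ring
  rw [absMoment, integral_gaussianReal_eq_integral_smul one_ne_zero]
  simp_rw [e]
  rw [integral_const_mul, integral_comp_abs
    (f := fun x => x ^ (1 : ℝ) * Real.exp (-(1 / 2) * x ^ (2 : ℝ))), h, ← Real.sqrt_inv,
    eq_comm, Real.sqrt_eq_iff_mul_self_eq (by positivity) (by positivity), mul_mul_mul_comm,
    Real.mul_self_sqrt (by positivity)]
  field_simp

lemma mul_sgn (w : ℝ) : w * sgn w = |w| := by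
  unfold sgn
  split_ifs with h
  · rw [mul_one, abs_of_nonneg h]
  · rw [mul_neg_one, abs_of_neg (not_le.1 h)]

lemma sgn_sq (w : ℝ) : sgn w ^ 2 = 1 := by
  unfold sgn
  split_ifs <;> norm_num

/-- The error of the threshold decoder in the 1-bit model. -/
lemma errorProb_sgn_le {p k n : ℕ} {σ : ℝ} (hσ : 0 < σ) (b : Fin k → ℝ) (hb : 0 < bMin b)
    (hn : 0 < n) {θ s : ℝ} (hθ0 : 0 < θ) (hθ1 : θ < 1)
    (hs : s = bMin b * √(2 / (Real.pi * obsVar σ b))) :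
    errorProb sgn σ b (thresholdDecoder p n (θ * (n * s))) ≤
      2 * p * Real.exp (-(θ ^ 2 * (n * s ^ 2 / 2))) + k * (1 / ((1 - θ) ^ 2 * (n * s ^ 2))) := by
  have hV := obsVar_pos hσ b
  have hpi := Real.pi_pos
  have hs0 : 0 < s := by rw [hs]; positivity
  have hn' : (0 : ℝ) < n := by exact_mod_cast hn
  have hsgn_le : ∀ w, ‖sgn w‖ ≤ 1 := fun w => by
    rw [Real.norm_eq_abs, ← sq_le_one_iff_abs_le_one, sgn_sq]
  have hL2 : ∀ (e : Fin k ↪ Fin p) (j : Fin p),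
      MemLp (fun ω => ω.1 j * sgn (rowSum (embSignal b e) ω)) 2 (rowLaw p σ) := by
    intro e j
    refine (memLp_rowLaw_eval σ j 2 (by simp)).mono
      ((measurable_fst.eval).mul (measurable_sgn.comp
        (measurable_rowSum _))).aestronglyMeasurable (ae_of_all _ fun ω => ?_)
    rw [norm_mul]
    exact mul_le_of_le_one_right (norm_nonneg _) (hsgn_le _)
  -- The squared observations are 1, so a null correlation is exactly Gaussian with variance n; `l =
  -- θ * s = t / n` minimizes n l²/2 - l t.
  refine (errorProb_thresholdDecoder_le measurable_sgn σ b (l := θ * s) (κ := (θ * s) ^ 2 / 2)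
    (D := 1) (s := s) (by positivity) ?_ hL2 ?_ ?_ ?_ zero_le_one).trans_eq ?_
  · intro e j hj r hr
    rw [lintegral_exp_eval_mul_rowSum hσ (embSignal_of_notMem b e hj) measurable_sgn]
    have : r ^ 2 = (θ * s) ^ 2 := by rcases hr with rfl | rfl <;> ring
    simp [sgn_sq, this]
  · intro e j
    have : ∀ ω : (Fin p → ℝ) × ℝ, (ω.1 j * sgn (rowSum (embSignal b e) ω)) ^ 2 = |ω.1 j| ^ 2 := by
      intro ω
      rw [mul_pow, sgn_sq, mul_one, sq_abs]
    simp_rw [this]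
    rw [MeasurePreserving.integral_comp_real (measurePreserving_rowLaw_eval σ j)
        (F := fun x => |x| ^ 2) (by fun_prop)]
    exact absMoment_two.le
  · intro e i
    rw [integral_eval_mul_rowSum hσ _ _ measurable_sgn
      (MemLp.of_bound measurable_sgn.aestronglyMeasurable 1 (ae_of_all _ hsgn_le)),
      embSignal_apply, rowVar_embSignal]
    have h1 := integral_abs_pow_gaussianReal hV.le 1
    simp only [pow_one] at h1
    simp only [mul_sgn, h1, absMoment_one]
    rw [abs_mul, abs_div, abs_of_pos hV, ← Real.sqrt_mul hV.le,
      abs_of_nonneg (Real.sqrt_nonneg _), hs]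
    have e1 : √(obsVar σ b * (2 / Real.pi)) = obsVar σ b * √(2 / (Real.pi * obsVar σ b)) := by
      conv_rhs => rw [← Real.sqrt_sq hV.le]
      rw [← Real.sqrt_mul (sq_nonneg _), Real.sqrt_sq hV.le]
      congr 1
      field_simp
    rw [e1, div_mul_eq_mul_div, mul_left_comm, mul_div_cancel_left₀ _ hV.ne']
    exact mul_le_mul_of_nonneg_right (bMin_le b i) (Real.sqrt_nonneg _)
  · have : 0 < n * s := by positivity
    nlinarith
  · have h1 : (1 - θ) ≠ 0 := by linarith
    have e1 : n * ((θ * s) ^ 2 / 2) - θ * s * (θ * (n * s)) = -(θ ^ 2 * (n * s ^ 2 / 2)) := by ring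
    have e2 : n * s - θ * (n * s) = (1 - θ) * (n * s) := by ring
    rw [e1, e2]
    congr 2
    field_simp

/-- The error of the threshold decoder in the linear model. -/
lemma errorProb_linear_le {p k n : ℕ} {σ : ℝ} (hσ : 0 < σ) (b : Fin k → ℝ) (hb : 0 < bMin b)
    (hn : 0 < n) {θ δ W : ℝ} (hθ0 : 0 < θ) (hθ1 : θ < 1) (hδ : 0 < δ)
    (hW : W = obsVar σ b * (1 + δ)) (hsmall : bMin b ^ 2 ≤ δ * obsVar σ b) :
    errorProb id σ b (thresholdDecoder p n (θ * (n * bMin b))) ≤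
      2 * p * Real.exp (-(θ ^ 2 * (n * bMin b ^ 2 / (2 * W)))) +
        k * ((absMoment 4 * (1 + obsVar σ b ^ 2) / 2) / ((1 - θ) ^ 2 * (n * bMin b ^ 2))) := by
  have hV := obsVar_pos hσ b
  set V := obsVar σ b with hVdef
  set s := bMin b with hsdef
  have hn' : (0 : ℝ) < n := by exact_mod_cast hn
  have hW0 : 0 < W := by rw [hW]; positivity
  have h4 := absMoment_nonneg 4
  -- The minimizer of n l² W/2 - l t at t = θ n s. The inflated variance `W` pays for the
  -- non-Gaussian moment generating function of a product of two Gaussians.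
  set l := θ * s / W with hl
  have hl0 : 0 < l := by positivity
  -- Equivalent to 1/(1 - l²V) ≤ 1 + δ, which bounds the null exponent by l²W/2.
  have hlV : l ^ 2 * V * (1 + δ) ≤ δ := by
    have : l ^ 2 * V * (1 + δ) = θ ^ 2 * s ^ 2 / W := by
      rw [hl, hW]; field_simp
    rw [this, div_le_iff₀ hW0, hW]
    have : θ ^ 2 * s ^ 2 ≤ 1 * s ^ 2 := by
      have : θ ^ 2 ≤ 1 := by nlinarith
      gcongr
    nlinarith [mul_pos hδ (mul_pos hδ hV)]
  have hlV1 : l ^ 2 * V < 1 := by nlinarith [mul_pos (pow_pos hl0 2) hV]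
  have hrow4 : ∀ e : Fin k ↪ Fin p, Integrable (fun ω => |rowSum (embSignal b e) ω| ^ 4)
      (rowLaw p σ) := fun e =>
    (measurePreserving_rowSum σ _).integrable_comp_of_integrable
      (integrable_abs_pow_gaussianReal _ 4)
  have heval4 : ∀ j : Fin p, Integrable (fun ω : (Fin p → ℝ) × ℝ => |ω.1 j| ^ 4) (rowLaw p σ) :=
    fun j => (measurePreserving_rowLaw_eval σ j).integrable_comp_of_integrable
      (integrable_abs_pow_gaussianReal _ 4)
  -- A relevant column and the observation are dependent; this bound needs only their separate
  -- fourth moments.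
  have hbound : ∀ x y : ℝ, (x * y) ^ 2 ≤ (|x| ^ 4 + |y| ^ 4) / 2 := fun x y => by
    rw [Even.pow_abs (by decide), Even.pow_abs (by decide)]
    nlinarith [sq_nonneg (x ^ 2 - y ^ 2)]
  have hL2 : ∀ (e : Fin k ↪ Fin p) (j : Fin p),
      MemLp (fun ω => ω.1 j * id (rowSum (embSignal b e) ω)) 2 (rowLaw p σ) := by
    intro e j
    simp only [id]
    rw [memLp_two_iff_integrable_sq (by fun_prop)]
    refine (((heval4 j).add (hrow4 e)).div_const 2).mono' (by fun_prop) (ae_of_all _ fun ω => ?_)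
    rw [Real.norm_eq_abs, abs_of_nonneg (sq_nonneg _)]
    exact hbound _ _
  refine (errorProb_thresholdDecoder_le measurable_id σ b (l := l) (κ := l ^ 2 * W / 2)
    (D := absMoment 4 * (1 + V ^ 2) / 2) (s := s) hl0 ?_ hL2 ?_ ?_ ?_ (by positivity)).trans_eq ?_
  · intro e j hj r hr
    rw [lintegral_exp_eval_mul_rowSum hσ (embSignal_of_notMem b e hj) measurable_id,
      rowVar_embSignal]
    have hr2 : r ^ 2 = l ^ 2 := by rcases hr with rfl | rfl <;> ring
    have hv0 : Real.toNNReal V ≠ 0 := by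
      rw [Ne, Real.toNNReal_eq_zero, not_le]; exact hV
    have e1 : 2 * (l ^ 2 / 2) * ((Real.toNNReal V : ℝ≥0) : ℝ) = l ^ 2 * V := by
      rw [Real.coe_toNNReal V hV.le]; ring
    simp only [id, hr2]
    rw [← ofReal_integral_eq_lintegral_ofReal
      (integrable_exp_sq_gaussianReal hv0 (by rw [e1]; exact hlV1))
      (ae_of_all _ fun _ => by positivity),
      integral_exp_sq_gaussianReal hv0 (by rw [e1]; exact hlV1), e1]
    refine ENNReal.ofReal_le_ofReal ((inv_sqrt_one_sub_le hlV1).trans (Real.exp_le_exp.2 ?_))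
    have h1 : 0 < 1 - l ^ 2 * V := by linarith
    rw [div_le_div_iff₀ (by positivity) (by norm_num), hW]
    have h2 : 1 ≤ (1 + δ) * (1 - l ^ 2 * V) := by nlinarith
    have h3 : 0 ≤ l ^ 2 * V := by positivity
    nlinarith [mul_le_mul_of_nonneg_left h2 h3]
  · intro e j
    have h1 := integral_mono (μ := rowLaw p σ) (hL2 e j).integrable_sq
      (((heval4 j).add (hrow4 e)).div_const 2) fun ω => hbound _ _
    refine h1.trans_eq ?_
    have h2 := integral_abs_pow_gaussianReal hV.le 4
    have h3 : √V ^ 4 = V ^ 2 := by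
      rw [show 4 = 2 * 2 from rfl, pow_mul, Real.sq_sqrt hV.le]
    rw [integral_div]
    simp only [Pi.add_apply]
    rw [integral_add (heval4 j) (hrow4 e),
      MeasurePreserving.integral_comp_real (measurePreserving_rowLaw_eval σ j)
        (F := fun x => |x| ^ 4) (by fun_prop),
      MeasurePreserving.integral_comp_real (measurePreserving_rowSum σ _)
        (F := fun x => |x| ^ 4) (by fun_prop), rowVar_embSignal, ← hVdef, h2, h3, ← absMoment]
    ring
  · intro e i
    rw [integral_eval_mul_rowSum hσ _ _ measurable_id (memLp_id_gaussianReal' 2 (by simp)),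
      embSignal_apply, rowVar_embSignal]
    have h1 := integral_abs_pow_gaussianReal hV.le 2
    rw [absMoment_two, Real.sq_sqrt hV.le, mul_one] at h1
    simp only [sq_abs] at h1
    simp only [id, ← sq, ← hVdef, h1]
    rw [div_mul_cancel₀ _ hV.ne']
    exact bMin_le b i
  · have : 0 < n * s := by positivity
    nlinarith
  · have h1 : (1 - θ) ≠ 0 := by linarith
    have e1 : n * (l ^ 2 * W / 2) - l * (θ * (n * s)) = -(θ ^ 2 * (n * s ^ 2 / (2 * W))) := by
      rw [hl]; field_simp; ring
    have e2 : n * s - θ * (n * s) = (1 - θ) * (n * s) := by ring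
    rw [e1, e2]
    congr 2
    field_simp

/-! ### Asymptotics -/

/-- Every square is at least b_min², so no set beats the singleton of an entry of smallest modulus.
-/
lemma oneBitThreshold_eq {k p : ℕ} (hk : 0 < k) {σ : ℝ} (hσ : 0 < σ) (b : Fin k → ℝ)
    (hb : 0 < bMin b) :
    oneBitThreshold p σ b = Real.pi * σ ^ 2 * Real.log p / bMin b ^ 2 := by
  have hpi := Real.pi_pos
  have hL : 0 ≤ Real.log p := Real.log_natCast_nonneg p
  have : Nonempty {s : Finset (Fin k) // s.Nonempty} :=
    ⟨⟨{⟨0, hk⟩}, Finset.singleton_nonempty _⟩⟩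
  refine le_antisymm (ciSup_le fun s => ?_) ?_
  · have hcard : (0 : ℝ) < s.1.card := by exact_mod_cast s.2.card_pos
    have hsum : (s.1.card : ℝ) * bMin b ^ 2 ≤ ∑ i ∈ s.1, b i ^ 2 := by
      rw [← nsmul_eq_mul, ← Finset.sum_const]
      refine Finset.sum_le_sum fun i _ => ?_
      rw [← sq_abs (b i)]
      exact pow_le_pow_left₀ hb.le (bMin_le b i) 2
    have hpos : 0 < ∑ i ∈ s.1, b i ^ 2 := lt_of_lt_of_le (by positivity) hsum
    rw [div_le_div_iff₀ (by positivity) (by positivity)]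
    have e : Real.pi * σ ^ 2 * Real.log p * (1 / (Real.pi * σ ^ 2) * ∑ i ∈ s.1, b i ^ 2) =
        Real.log p * ∑ i ∈ s.1, b i ^ 2 := by field_simp
    rw [e]
    nlinarith [mul_le_mul_of_nonneg_left hsum hL]
  · obtain ⟨i, hi⟩ := exists_bMin_eq hk b
    refine le_trans (le_of_eq ?_) (le_ciSup (Set.finite_range _).bddAbove
      (⟨{i}, Finset.singleton_nonempty i⟩ : {s : Finset (Fin k) // s.Nonempty}))
    simp only [Finset.card_singleton, Finset.sum_singleton, Nat.cast_one, one_mul]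
    rw [← hi, sq_abs]
    have : b i ≠ 0 := by
      rw [← abs_pos, hi]; exact hb
    field_simp

lemma tendsto_exp_neg_mul_log {a : ℝ} (ha : 0 < a) :
    Tendsto (fun p : ℕ => Real.exp (-(a * Real.log p))) atTop (𝓝 0) := by
  have h := (Real.tendsto_log_atTop.comp tendsto_natCast_atTop_atTop).const_mul_atTop ha
  exact Real.tendsto_exp_neg_atTop_nhds_zero.comp h

/-- False alarms contribute at most 2 p^(1 - θ²a) and misses O(1/log p). -/
lemma tendsto_zero_of_le {err A N D K : ℕ → ℝ} {θ a c D₀ K₀ : ℝ} (hθ1 : θ < 1) (hc : 0 < c)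
    (ha : 1 < θ ^ 2 * a) (herr : ∀ p, 0 ≤ err p)
    (hA : ∀ᶠ p : ℕ in atTop, a * Real.log p ≤ A p) (hN : ∀ᶠ p : ℕ in atTop, c * Real.log p ≤ N p)
    (hD : ∀ᶠ p in atTop, 0 ≤ D p ∧ D p ≤ D₀) (hK : ∀ᶠ p in atTop, 0 ≤ K p ∧ K p ≤ K₀)
    (h : ∀ᶠ p : ℕ in atTop,
      err p ≤ 2 * p * Real.exp (-(θ ^ 2 * A p)) + K p * (D p / ((1 - θ) ^ 2 * N p))) :
    Tendsto err atTop (𝓝 0) := by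
  have hlog : Tendsto (fun p : ℕ => Real.log p) atTop atTop :=
    Real.tendsto_log_atTop.comp tendsto_natCast_atTop_atTop
  have h1 := (tendsto_exp_neg_mul_log (sub_pos.2 ha)).const_mul 2
  have h2 : Tendsto (fun p : ℕ => K₀ * (D₀ / ((1 - θ) ^ 2 * c)) / Real.log p) atTop (𝓝 0) :=
    hlog.const_div_atTop _
  have h3 := h1.add h2
  rw [mul_zero, add_zero] at h3
  refine squeeze_zero' (Eventually.of_forall herr) ?_ h3
  filter_upwards [hA, hN, hD, hK, h, eventually_ge_atTop 1, hlog.eventually_gt_atTop 0] with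
    p hA hN hD hK h hp hL
  have hθ : 0 < 1 - θ := by linarith
  have hp' : (0 : ℝ) < p := by exact_mod_cast hp
  refine h.trans (add_le_add ?_ ?_)
  · rw [mul_assoc]
    refine mul_le_mul_of_nonneg_left ?_ zero_le_two
    conv_lhs => rw [← Real.exp_log hp']
    rw [← Real.exp_add, Real.exp_le_exp]
    have := mul_le_mul_of_nonneg_left hA (sq_nonneg θ)
    have e : Real.exp (Real.log p) = p := Real.exp_log hp'
    linarith
  · have hc' : 0 < c * Real.log p := mul_pos hc hL
    calc K p * (D p / ((1 - θ) ^ 2 * N p)) ≤ K₀ * (D₀ / ((1 - θ) ^ 2 * (c * Real.log p))) := by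
          have := hD.1.trans hD.2
          refine mul_le_mul hK.2 (div_le_div₀ this hD.2 (by positivity) (by gcongr)) ?_
            (hK.1.trans hK.2)
          have : 0 < N p := hc'.trans_le hN
          exact div_nonneg hD.1 (by positivity)
      _ = _ := by field_simp

lemma tendsto_one_of_le {err M : ℕ → ℝ} {k : ℕ → ℕ} {ρ η K₀ : ℝ} (hρ : 0 < ρ) (hη : 0 < η)
    (herr : ∀ p, err p ≤ 1) (hK : ∀ᶠ p in atTop, (k p : ℝ) ≤ K₀)
    (hM : ∀ᶠ p : ℕ in atTop, M p ≤ Real.exp (ρ * ((1 - η / 2) * Real.log p)))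
    (h : ∀ᶠ p : ℕ in atTop, ∀ c : ℝ, 0 < c →
      1 - err p ≤ c / ((p : ℝ) - k p + 1) + c ^ (-ρ) * M p) :
    Tendsto err atTop (𝓝 1) := by
  have h1 := (tendsto_exp_neg_mul_log (a := η / 4) (by positivity)).const_mul 2
  have h2 := tendsto_exp_neg_mul_log (a := ρ * (η / 4)) (by positivity)
  have h3 := (h1.add h2).const_sub 1
  rw [mul_zero, add_zero, sub_zero] at h3
  refine tendsto_of_tendsto_of_tendsto_of_le_of_le' h3 tendsto_const_nhds ?_
    (Eventually.of_forall herr)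
  filter_upwards [hK, hM, h, eventually_ge_atTop 1,
    tendsto_natCast_atTop_atTop.eventually_ge_atTop (2 * K₀)] with p hK hM h hp hpK
  have hp' : (0 : ℝ) < p := by exact_mod_cast hp
  -- The choice c = p^(1-η/4) lies between p^(1-η/2), the rate allowed by the moment, and p, the
  -- number of candidates; both error terms become negative powers of p.
  have hc := h _ (Real.exp_pos ((1 - η / 4) * Real.log p))
  have e1 : Real.exp ((1 - η / 4) * Real.log p) / ((p : ℝ) - k p + 1) ≤
      2 * Real.exp (-(η / 4 * Real.log p)) := by
    have e : (1 - η / 4) * Real.log p = -(η / 4 * Real.log p) + Real.log p := by ring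
    rw [e, Real.exp_add, Real.exp_log hp', div_le_iff₀ (by linarith)]
    have := Real.exp_pos (-(η / 4 * Real.log p))
    nlinarith
  have e2 : Real.exp ((1 - η / 4) * Real.log p) ^ (-ρ) * M p ≤
      Real.exp (-(ρ * (η / 4) * Real.log p)) := by
    refine (mul_le_mul_of_nonneg_left hM (Real.rpow_nonneg (Real.exp_pos _).le _)).trans_eq ?_
    rw [← Real.exp_mul, ← Real.exp_add]
    congr 1
    ring
  linarith

/-- The bounds that hold for all large `p` in the regime of fixed sparsity, fixed noise level and
comparable entries. -/
structure Bounds (k : ℕ) (σ : ℝ) (b : Fin k → ℝ) (K s₁ s₂ C : ℝ) : Prop where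
  pos : 0 < k
  le : (k : ℝ) ≤ K
  sigma_pos : 0 < σ
  le_sigma : s₁ ≤ σ ^ 2
  sigma_le : σ ^ 2 ≤ s₂
  bMin_pos : 0 < bMin b
  bMax_le : bMax b ≤ C * bMin b

lemma exists_bounds (k : ℕ → ℕ) (σ : ℕ → ℝ) (b : (p : ℕ) → Fin (k p) → ℝ)
    (hk : (fun p => (k p : ℝ)) =Θ[atTop] fun _ => (1 : ℝ)) (hσpos : ∀ p, 0 < σ p)
    (hσ : (fun p => σ p ^ 2) =Θ[atTop] fun _ => (1 : ℝ))
    (hbpos : ∀ᶠ p in atTop, 0 < bMin (b p))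
    (hb : (fun p => bMin (b p)) =Θ[atTop] fun p => bMax (b p)) :
    ∃ K s₁ s₂ C : ℝ, 0 < K ∧ 0 < s₁ ∧ 0 < s₂ ∧ 0 < C ∧
      ∀ᶠ p in atTop, Bounds (k p) (σ p) (b p) K s₁ s₂ C := by
  obtain ⟨K, hK0, hK⟩ := hk.1.exists_pos
  obtain ⟨s₂, hs₂0, hs₂⟩ := hσ.1.exists_pos
  obtain ⟨s₁, hs₁0, hs₁⟩ := hσ.2.exists_pos
  obtain ⟨C, hC0, hC⟩ := hb.2.exists_pos
  refine ⟨K, s₁⁻¹, s₂, C, hK0, inv_pos.2 hs₁0, hs₂0, hC0, ?_⟩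
  filter_upwards [hK.bound, hs₂.bound, hs₁.bound, hC.bound, hbpos] with p h1 h2 h3 h4 h5
  simp only [Real.norm_eq_abs, abs_one, mul_one, Nat.abs_cast, abs_pow, sq_abs] at h1 h2 h3
  -- An infimum over the empty index set is 0 in `ℝ`, so `0 < bMin` rules out `k p = 0`.
  have hkpos : 0 < k p := by
    rcases Nat.eq_zero_or_pos (k p) with h | h
    · have hem : IsEmpty (Fin (k p)) := by rw [h]; infer_instance
      rw [bMin, Real.iInf_of_isEmpty] at h5
      exact absurd h5 (lt_irrefl _)
    · exact h
  refine ⟨hkpos, h1, hσpos p, ?_, h2, h5, ?_⟩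
  · rw [inv_le_iff_one_le_mul₀' hs₁0]
    exact h3
  · rw [Real.norm_eq_abs, Real.norm_eq_abs, abs_of_pos h5] at h4
    exact (le_abs_self _).trans h4

lemma Bounds.obsVar_le {k : ℕ} {σ : ℝ} {b : Fin k → ℝ} {K s₁ s₂ C δ : ℝ}
    (h : Bounds k σ b K s₁ s₂ C) (hδ : 0 < δ) (hm : K * C ^ 2 * bMin b ^ 2 ≤ δ * s₁) :
    obsVar σ b ≤ σ ^ 2 * (1 + δ) := by
  have hsum : ∑ i, b i ^ 2 ≤ K * C ^ 2 * bMin b ^ 2 := by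
    calc ∑ i, b i ^ 2 ≤ ∑ _i : Fin k, (C * bMin b) ^ 2 := by
          refine Finset.sum_le_sum fun i _ => ?_
          rw [← sq_abs]
          exact pow_le_pow_left₀ (abs_nonneg _) ((le_bMax b i).trans h.bMax_le) 2
      _ = k * (C ^ 2 * bMin b ^ 2) := by simp [mul_pow]
      _ ≤ K * (C ^ 2 * bMin b ^ 2) := mul_le_mul_of_nonneg_right h.le (by positivity)
      _ = _ := by ring
  have := mul_le_mul_of_nonneg_left h.le_sigma hδ.le
  rw [obsVar]
  linarith

lemma exists_margin {η : ℝ} (hη : 0 < η) :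
    ∃ δ : ℝ, 0 < δ ∧ (1 + δ) ^ 2 * (1 + η / 2) ≤ 1 + η := by
  -- As δ ≤ 1, (1+δ)² ≤ 1 + 3δ, and 3δ(1+η) = η/2.
  refine ⟨η / (6 * (1 + η)), by positivity, ?_⟩
  have h1 : η / (6 * (1 + η)) ≤ 1 := by
    rw [div_le_one (by positivity)]; linarith
  have h0 : 0 < η / (6 * (1 + η)) := by positivity
  have h2 : η / (6 * (1 + η)) * (6 * (1 + η)) = η := by field_simp
  set δ := η / (6 * (1 + η))
  nlinarith [mul_pos h0 hη]

lemma exists_contraction {η : ℝ} (hη : 0 < η) :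
    ∃ θ : ℝ, 0 < θ ∧ θ < 1 ∧ 1 < θ ^ 2 * (1 + η / 2) := by
  refine ⟨√((1 + η / 4) / (1 + η / 2)), by positivity, ?_, ?_⟩
  · rw [Real.sqrt_lt' one_pos, one_pow, div_lt_one (by positivity)]
    linarith
  · rw [Real.sq_sqrt (by positivity), div_mul_cancel₀ _ (by positivity)]
    linarith

/-! ### Achievability in the limit -/

section Limits

variable {k : ℕ → ℕ} {σ : ℕ → ℝ} {b : (p : ℕ) → Fin (k p) → ℝ} {K s₁ s₂ C η : ℝ} {n : ℕ → ℕ}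

lemma eventually_mul_bMin_sq_le (hbo : Tendsto (fun p => bMin (b p)) atTop (𝓝 0)) (c : ℝ) {d : ℝ}
    (hd : 0 < d) : ∀ᶠ p in atTop, c * bMin (b p) ^ 2 ≤ d := by
  have h := (hbo.pow 2).const_mul c
  simp only [ne_eq, OfNat.ofNat_ne_zero, not_false_eq_true, zero_pow, mul_zero] at h
  exact (h.eventually_lt_const hd).mono fun _ h => h.le

/-- The null exponent n s²/2 = n b_min²/(πV) is at least (1+η/2) log p since V ≤ σ²(1+δ); the
remaining η/2 allows θ < 1. -/
theorem tendsto_errorProb_sgn_zero (hs₁ : 0 < s₁)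
    (hB : ∀ᶠ p in atTop, Bounds (k p) (σ p) (b p) K s₁ s₂ C)
    (hbo : Tendsto (fun p => bMin (b p)) atTop (𝓝 0)) (hη : 0 < η)
    (hn : ∀ᶠ p in atTop, oneBitThreshold p (σ p) (b p) * (1 + η) ≤ (n p : ℝ)) :
    ∃ dec : (p : ℕ) → Decoder p (n p),
      Tendsto (fun p => errorProb sgn (σ p) (b p) (dec p)) atTop (𝓝 0) := by
  obtain ⟨δ, hδ0, hδ⟩ := exists_margin hη
  obtain ⟨θ, hθ0, hθ1, hθ⟩ := exists_contraction hη
  set s : ℕ → ℝ := fun p => bMin (b p) * √(2 / (Real.pi * obsVar (σ p) (b p))) with hs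
  have hpi := Real.pi_pos
  have hlog : Tendsto (fun p : ℕ => Real.log p) atTop atTop :=
    Real.tendsto_log_atTop.comp tendsto_natCast_atTop_atTop
  have key : ∀ᶠ p : ℕ in atTop, 0 < n p ∧
      (1 + η / 2) * Real.log p ≤ n p * s p ^ 2 / 2 := by
    filter_upwards [hB, hn, hlog.eventually_gt_atTop 0,
      eventually_mul_bMin_sq_le hbo (K * C ^ 2) (mul_pos hδ0 hs₁)] with p hB hn hL hm
    have hb := hB.bMin_pos
    have hσ := hB.sigma_pos
    have hV := obsVar_pos hσ (b p)
    have hVle := hB.obsVar_le hδ0 hm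
    rw [oneBitThreshold_eq hB.pos hσ _ hb] at hn
    have hn0 : (0 : ℝ) < n p := lt_of_lt_of_le (by positivity) hn
    refine ⟨by exact_mod_cast hn0, ?_⟩
    have e : n p * s p ^ 2 / 2 = n p * (bMin (b p) ^ 2 / (Real.pi * obsVar (σ p) (b p))) := by
      rw [hs]
      simp only
      rw [mul_pow, Real.sq_sqrt (by positivity)]
      field_simp
    rw [e]
    refine le_trans ?_ (mul_le_mul_of_nonneg_right hn (by positivity))
    have e2 : Real.pi * σ p ^ 2 * Real.log p / bMin (b p) ^ 2 * (1 + η) *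
        (bMin (b p) ^ 2 / (Real.pi * obsVar (σ p) (b p))) =
        Real.log p * ((1 + η) * σ p ^ 2 / obsVar (σ p) (b p)) := by field_simp
    rw [e2, mul_comm]
    refine mul_le_mul_of_nonneg_left ?_ hL.le
    rw [le_div_iff₀ hV]
    have h1 : (1 + δ) * (1 + η / 2) ≤ 1 + η := by nlinarith
    calc (1 + η / 2) * obsVar (σ p) (b p) ≤ (1 + η / 2) * (σ p ^ 2 * (1 + δ)) := by gcongr
      _ = (1 + δ) * (1 + η / 2) * σ p ^ 2 := by ring
      _ ≤ _ := by gcongr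
  refine ⟨fun p => thresholdDecoder p (n p) (θ * (n p * s p)), ?_⟩
  refine tendsto_zero_of_le (A := fun p => n p * s p ^ 2 / 2) (N := fun p => n p * s p ^ 2)
    (D := fun _ => 1) (K := fun p => k p) (D₀ := 1) (K₀ := K) (c := 1) hθ1 one_pos hθ
    (fun p => errorProb_nonneg _ _ _ _) (key.mono fun p h => h.2) ?_
    (Eventually.of_forall fun _ => ⟨zero_le_one, le_rfl⟩)
    (hB.mono fun p h => ⟨by positivity, h.le⟩) ?_
  · filter_upwards [key, hlog.eventually_gt_atTop 0] with p h hL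
    nlinarith [h.2]
  · filter_upwards [key, hB] with p h hB
    exact errorProb_sgn_le hB.sigma_pos (b p) hB.bMin_pos h.1 hθ0 hθ1 rfl

/-- The margin 1+δ is spent twice, on V ≤ σ²(1+δ) and on W = V(1+δ). -/
theorem tendsto_errorProb_linear_zero (hs₁ : 0 < s₁)
    (hB : ∀ᶠ p in atTop, Bounds (k p) (σ p) (b p) K s₁ s₂ C)
    (hbo : Tendsto (fun p => bMin (b p)) atTop (𝓝 0)) (hη : 0 < η)
    (hn : ∀ᶠ p in atTop,
      oneBitThreshold p (σ p) (b p) / (Real.pi / 2) * (1 + η) ≤ (n p : ℝ)) :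
    ∃ dec : (p : ℕ) → Decoder p (n p),
      Tendsto (fun p => errorProb id (σ p) (b p) (dec p)) atTop (𝓝 0) := by
  obtain ⟨δ, hδ0, hδ⟩ := exists_margin hη
  obtain ⟨θ, hθ0, hθ1, hθ⟩ := exists_contraction hη
  have hpi := Real.pi_pos
  have hlog : Tendsto (fun p : ℕ => Real.log p) atTop atTop :=
    Real.tendsto_log_atTop.comp tendsto_natCast_atTop_atTop
  set W : ℕ → ℝ := fun p => obsVar (σ p) (b p) * (1 + δ) with hW
  have key : ∀ᶠ p : ℕ in atTop, 0 < n p ∧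
      (1 + η / 2) * Real.log p ≤ n p * bMin (b p) ^ 2 / (2 * W p) ∧
      2 * s₁ * Real.log p ≤ n p * bMin (b p) ^ 2 ∧
      bMin (b p) ^ 2 ≤ δ * obsVar (σ p) (b p) ∧ obsVar (σ p) (b p) ≤ s₂ * (1 + δ) := by
    filter_upwards [hB, hn, hlog.eventually_gt_atTop 0,
      eventually_mul_bMin_sq_le hbo (K * C ^ 2) (mul_pos hδ0 hs₁),
      eventually_mul_bMin_sq_le hbo 1 (mul_pos hδ0 hs₁)] with p hB hn hL hm hm1
    have hb := hB.bMin_pos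
    have hσ := hB.sigma_pos
    have hV := obsVar_pos hσ (b p)
    have hVle := hB.obsVar_le hδ0 hm
    have hσV : σ p ^ 2 ≤ obsVar (σ p) (b p) :=
      le_add_of_nonneg_right (Finset.sum_nonneg fun _ _ => sq_nonneg _)
    rw [oneBitThreshold_eq hB.pos hσ _ hb] at hn
    have hn0 : (0 : ℝ) < n p := lt_of_lt_of_le (by positivity) hn
    have hn2 : 2 * σ p ^ 2 * Real.log p * (1 + η) ≤ n p * bMin (b p) ^ 2 := by
      refine le_trans (le_of_eq ?_) (mul_le_mul_of_nonneg_right hn (sq_nonneg _))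
      field_simp
    refine ⟨by exact_mod_cast hn0, ?_, ?_, ?_, ?_⟩
    · rw [le_div_iff₀ (by positivity)]
      refine le_trans ?_ hn2
      calc (1 + η / 2) * Real.log p * (2 * W p)
          ≤ (1 + η / 2) * Real.log p * (2 * (σ p ^ 2 * (1 + δ) * (1 + δ))) := by
            simp only [hW]; gcongr
        _ = 2 * σ p ^ 2 * Real.log p * ((1 + δ) ^ 2 * (1 + η / 2)) := by ring
        _ ≤ _ := by gcongr
    · refine le_trans ?_ hn2
      calc 2 * s₁ * Real.log p ≤ 2 * σ p ^ 2 * Real.log p * 1 := by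
            rw [mul_one]; have := hB.le_sigma; gcongr
        _ ≤ _ := by gcongr; linarith
    · rw [one_mul] at hm1
      exact hm1.trans (mul_le_mul_of_nonneg_left (hB.le_sigma.trans hσV) hδ0.le)
    · exact hVle.trans (mul_le_mul_of_nonneg_right hB.sigma_le (by positivity))
  refine ⟨fun p => thresholdDecoder p (n p) (θ * (n p * bMin (b p))), ?_⟩
  have h4 := absMoment_nonneg 4
  refine tendsto_zero_of_le (A := fun p => n p * bMin (b p) ^ 2 / (2 * W p))
    (N := fun p => n p * bMin (b p) ^ 2)
    (D := fun p => absMoment 4 * (1 + obsVar (σ p) (b p) ^ 2) / 2)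
    (K := fun p => k p) (D₀ := absMoment 4 * (1 + (s₂ * (1 + δ)) ^ 2) / 2) (K₀ := K)
    (c := 2 * s₁) hθ1 (by positivity) hθ
    (fun p => errorProb_nonneg _ _ _ _) (key.mono fun p h => h.2.1) (key.mono fun p h => h.2.2.1) ?_
    (hB.mono fun p h => ⟨by positivity, h.le⟩) ?_
  · filter_upwards [key, hB] with p h hB
    have hV := obsVar_pos hB.sigma_pos (b p)
    have := h.2.2.2.2
    exact ⟨by positivity, by gcongr⟩
  · filter_upwards [key, hB] with p h hB
    exact errorProb_linear_le hB.sigma_pos (b p) hB.bMin_pos h.1 hθ0 hθ1 hδ0 rfl h.2.2.2.1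

end Limits

/-! ### Converse in the limit -/

section Converse

variable {k : ℕ → ℕ} {σ : ℕ → ℝ} {b : (p : ℕ) → Fin (k p) → ℝ} {K s₁ s₂ C η : ℝ} {n : ℕ → ℕ}

lemma eventually_sparse (hB : ∀ᶠ p in atTop, Bounds (k p) (σ p) (b p) K s₁ s₂ C) :
    ∀ᶠ p in atTop, k p ≤ p := by
  filter_upwards [hB, tendsto_natCast_atTop_atTop.eventually_ge_atTop K] with p hB hp
  exact_mod_cast hB.le.trans hp

theorem tendsto_errorProb_linear_one (hs₁ : 0 < s₁)
    (hB : ∀ᶠ p in atTop, Bounds (k p) (σ p) (b p) K s₁ s₂ C)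
    (hbo : Tendsto (fun p => bMin (b p)) atTop (𝓝 0)) (hη : 0 < η)
    (hn : ∀ᶠ p in atTop,
      (n p : ℝ) ≤ oneBitThreshold p (σ p) (b p) / (Real.pi / 2) * (1 - η))
    (dec : (p : ℕ) → Decoder p (n p)) :
    Tendsto (fun p => errorProb id (σ p) (b p) (dec p)) atTop (𝓝 1) := by
  have hpi := Real.pi_pos
  set ρ := η / 4 with hρ
  have hρ0 : 0 < ρ := by positivity
  have hρ' : (1 + ρ) * (1 + ρ) * (1 - η) ≤ 1 - η / 2 := by
    rw [hρ]; nlinarith [mul_pos hη (mul_pos hη hη)]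
  set u : ℕ → ℝ := fun p => ρ * (1 + ρ) * bMin (b p) ^ 2 / σ p ^ 2 with hu
  -- This makes 1/(1-u) ≤ 1+ρ, so the second-order effect of `u` costs only one more factor 1+ρ,
  -- paid for by the gap between 1-η and 1-η/2.
  have hsmall : ∀ᶠ p in atTop, u p ≤ ρ / (1 + ρ) := by
    filter_upwards [hB, eventually_mul_bMin_sq_le hbo (ρ * (1 + ρ))
      (show 0 < ρ / (1 + ρ) * s₁ by positivity)] with p hB hm
    have hσ := hB.sigma_pos
    simp only [hu]
    rw [div_le_iff₀ (by positivity)]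
    exact hm.trans (mul_le_mul_of_nonneg_left hB.le_sigma (by positivity))
  have hlt : ρ / (1 + ρ) < 1 := by rw [div_lt_one (by positivity)]; linarith
  refine tendsto_one_of_le (M := fun p => (√(1 - u p))⁻¹ ^ n p) (k := k) hρ0 hη
    (fun p => errorProb_le_one _ _ _ _) (hB.mono fun p h => h.le) ?_ ?_
  · filter_upwards [hB, hn, hsmall] with p hB hn hup
    have hb := hB.bMin_pos
    have hσ := hB.sigma_pos
    have hu1 : u p < 1 := hup.trans_lt hlt
    have hu0 : 0 ≤ u p := by simp only [hu]; positivity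
    rw [oneBitThreshold_eq hB.pos hσ _ hb] at hn
    have hL : 0 ≤ Real.log p := Real.log_natCast_nonneg p
    have h1u : 0 < 1 - u p := by linarith
    refine (pow_le_pow_left₀ (by positivity) (inv_sqrt_one_sub_le hu1) _).trans ?_
    rw [← Real.exp_nat_mul, Real.exp_le_exp]
    have hinv : (1 - u p)⁻¹ ≤ 1 + ρ := by
      rw [inv_le_iff_one_le_mul₀ h1u]
      have h2 : ρ / (1 + ρ) * (1 + ρ) = ρ := by field_simp
      nlinarith [mul_le_mul_of_nonneg_right hup (show 0 ≤ 1 + ρ by positivity)]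
    have hnu : n p * u p ≤ ρ * (1 + ρ) * 2 * Real.log p * (1 - η) := by
      refine (mul_le_mul_of_nonneg_right hn hu0).trans_eq ?_
      simp only [hu]
      field_simp
    calc n p * (u p / (2 * (1 - u p))) = n p * u p * (1 - u p)⁻¹ / 2 := by field_simp
      _ ≤ n p * u p * (1 + ρ) / 2 := by gcongr
      _ ≤ ρ * (1 + ρ) * 2 * Real.log p * (1 - η) * (1 + ρ) / 2 := by gcongr
      _ = ρ * (((1 + ρ) * (1 + ρ) * (1 - η)) * Real.log p) := by ring
      _ ≤ _ := by gcongr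
  · filter_upwards [hB, hsmall, eventually_sparse hB] with p hB hup hkp c hc
    obtain ⟨i, hi⟩ := exists_bMin_eq hB.pos (b p)
    have hsq : b p i ^ 2 = bMin (b p) ^ 2 := by rw [← hi, sq_abs]
    have h := one_sub_errorProb_linear_le hkp i (b p) hB.sigma_pos (dec p) hc hρ0
      (by rw [hsq]; exact hup.trans_lt hlt)
    rw [hsq] at h
    exact h

theorem tendsto_errorProb_sgn_one (hs₁ : 0 < s₁) (hs₂ : 0 < s₂) (hC : 0 < C)
    (hB : ∀ᶠ p in atTop, Bounds (k p) (σ p) (b p) K s₁ s₂ C)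
    (hbo : Tendsto (fun p => bMin (b p)) atTop (𝓝 0)) (hη : 0 < η) (hη1 : η ≤ 1)
    (hn : ∀ᶠ p in atTop, (n p : ℝ) ≤ oneBitThreshold p (σ p) (b p) * (1 - η))
    (dec : (p : ℕ) → Decoder p (n p)) :
    Tendsto (fun p => errorProb sgn (σ p) (b p) (dec p)) atTop (𝓝 1) := by
  have hpi := Real.pi_pos
  have h3 := absMoment_nonneg 3
  have h4 := absMoment_nonneg 4
  set ρ := η / 4 with hρ
  have hρ0 : 0 < ρ := by positivity
  have hρ1 : ρ ≤ 1 / 4 := by rw [hρ]; linarith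
  have hρ' : (1 + ρ) * (1 + ρ) * (1 - η) ≤ 1 - η / 2 := by
    rw [hρ]; nlinarith [mul_pos hη (mul_pos hη hη)]
  set ε := ρ / 4 with hε
  have hε0 : 0 < ε := by positivity
  have hε1 : ε ≤ 1 / 4 := by rw [hε]; linarith
  have hden : 0 < 1 / 4 - ε ^ 2 := by nlinarith
  -- The budget 1+ρ is split into 1+ρ/2 for the clipping level and ρ/2 for the cubic and quartic
  -- remainders.
  have hεinv : (1 / 4 - ε ^ 2)⁻¹ ≤ 4 * (1 + ρ / 2) := by
    rw [inv_le_iff_one_le_mul₀ hden, hε]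
    nlinarith [mul_pos hρ0 hρ0, mul_pos hρ0 (mul_pos hρ0 hρ0)]
  set P₀ := peak (√s₁) with hP₀
  have hpeak : ∀ p, Bounds (k p) (σ p) (b p) K s₁ s₂ C → peak (σ p) ≤ P₀ := by
    intro p h
    rw [hP₀, peak, peak, Real.sq_sqrt hs₁.le]
    have := h.le_sigma
    gcongr
  set x : ℕ → ℝ := fun p => ρ * (1 + ρ) / 2 * (peak (σ p) ^ 2 / (1 / 4 - ε ^ 2)) *
    bMin (b p) ^ 2 + 32 * peak (σ p) ^ 3 * absMoment 3 * bMin (b p) ^ 3 +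
    (peak (σ p) / ε) ^ 4 * k p ^ 4 * absMoment 4 * (C * bMin (b p)) ^ 4 with hx
  -- The remainders divided by b_min², which vanish as b_min → 0. Comparability of the entries,
  -- b_max ≤ C b_min, keeps the quartic term of the known entries of order b_min⁴.
  have hrem : ∀ᶠ p in atTop, 32 * P₀ ^ 3 * absMoment 3 * bMin (b p) +
      (P₀ / ε) ^ 4 * K ^ 4 * absMoment 4 * C ^ 4 * bMin (b p) ^ 2 ≤
        ρ * (1 + ρ) * (ρ / 2) / (Real.pi * s₂) := by
    have h1 := hbo.const_mul (32 * P₀ ^ 3 * absMoment 3)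
    have h2 := (hbo.pow 2).const_mul ((P₀ / ε) ^ 4 * K ^ 4 * absMoment 4 * C ^ 4)
    have h := h1.add h2
    simp only [ne_eq, OfNat.ofNat_ne_zero, not_false_eq_true, zero_pow, mul_zero, add_zero] at h
    exact (h.eventually_lt_const (show 0 < ρ * (1 + ρ) * (ρ / 2) / (Real.pi * s₂) by
      positivity)).mono fun _ h => h.le
  have hxle : ∀ᶠ p in atTop,
      x p ≤ ρ * (1 + ρ) * (1 + ρ) * (bMin (b p) ^ 2 / (Real.pi * σ p ^ 2)) := by
    filter_upwards [hB, hrem] with p hB hrem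
    have hb := hB.bMin_pos
    have hσ := hB.sigma_pos
    have hpk := (peak_pos hσ).le
    have hpk' := hpeak p hB
    have hk := hB.le
    have t1 : ρ * (1 + ρ) / 2 * (peak (σ p) ^ 2 / (1 / 4 - ε ^ 2)) * bMin (b p) ^ 2 ≤
        ρ * (1 + ρ) * (1 + ρ / 2) * (bMin (b p) ^ 2 / (Real.pi * σ p ^ 2)) := by
      calc _ ≤ ρ * (1 + ρ) / 2 * (peak (σ p) ^ 2 * (4 * (1 + ρ / 2))) * bMin (b p) ^ 2 := by
            rw [div_eq_mul_inv (peak (σ p) ^ 2)]; gcongr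
        _ = _ := by rw [peak_sq]; field_simp; ring
    have t2 : 32 * peak (σ p) ^ 3 * absMoment 3 * bMin (b p) ^ 3 +
        (peak (σ p) / ε) ^ 4 * k p ^ 4 * absMoment 4 * (C * bMin (b p)) ^ 4 ≤
        ρ * (1 + ρ) * (ρ / 2) * (bMin (b p) ^ 2 / (Real.pi * σ p ^ 2)) := by
      calc _ ≤ 32 * P₀ ^ 3 * absMoment 3 * bMin (b p) ^ 3 +
            (P₀ / ε) ^ 4 * K ^ 4 * absMoment 4 * (C * bMin (b p)) ^ 4 := by gcongr
        _ = (32 * P₀ ^ 3 * absMoment 3 * bMin (b p) +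
            (P₀ / ε) ^ 4 * K ^ 4 * absMoment 4 * C ^ 4 * bMin (b p) ^ 2) * bMin (b p) ^ 2 := by
            ring
        _ ≤ ρ * (1 + ρ) * (ρ / 2) / (Real.pi * s₂) * bMin (b p) ^ 2 := by gcongr
        _ ≤ ρ * (1 + ρ) * (ρ / 2) / (Real.pi * σ p ^ 2) * bMin (b p) ^ 2 := by
            have := hB.sigma_le
            gcongr
        _ = _ := by ring
    simp only [hx]
    nlinarith
  refine tendsto_one_of_le (M := fun p => (1 + x p) ^ n p) (k := k) hρ0 hη
    (fun p => errorProb_le_one _ _ _ _) (hB.mono fun p h => h.le) ?_ ?_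
  · filter_upwards [hB, hn, hxle] with p hB hn hxp
    have hb := hB.bMin_pos
    have hσ := hB.sigma_pos
    have hpk := (peak_pos hσ).le
    have hx0 : 0 ≤ x p := by simp only [hx]; positivity
    rw [oneBitThreshold_eq hB.pos hσ _ hb] at hn
    have hL : 0 ≤ Real.log p := Real.log_natCast_nonneg p
    refine (pow_le_pow_left₀ (by positivity) ((add_comm 1 (x p)).trans_le
      (Real.add_one_le_exp _)) _).trans ?_
    rw [← Real.exp_nat_mul, Real.exp_le_exp]
    have hnb : n p * (bMin (b p) ^ 2 / (Real.pi * σ p ^ 2)) ≤ Real.log p * (1 - η) := by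
      refine (mul_le_mul_of_nonneg_right hn (by positivity)).trans_eq ?_
      field_simp
    calc n p * x p ≤ n p * (ρ * (1 + ρ) * (1 + ρ) * (bMin (b p) ^ 2 / (Real.pi * σ p ^ 2))) := by
          gcongr
      _ = ρ * (1 + ρ) * (1 + ρ) * (n p * (bMin (b p) ^ 2 / (Real.pi * σ p ^ 2))) := by ring
      _ ≤ ρ * (1 + ρ) * (1 + ρ) * (Real.log p * (1 - η)) := by gcongr
      _ = ρ * (((1 + ρ) * (1 + ρ) * (1 - η)) * Real.log p) := by ring
      _ ≤ _ := by gcongr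
  · filter_upwards [hB, eventually_sparse hB] with p hB hkp c hc
    obtain ⟨i, hi⟩ := exists_bMin_eq hB.pos (b p)
    have hsq : b p i ^ 2 = bMin (b p) ^ 2 := by rw [← hi, sq_abs]
    have h := one_sub_errorProb_sgn_le hkp i (b p) hB.sigma_pos (dec p) hc hρ0 (by linarith) hε0
      hε1 (B := C * bMin (b p)) fun i => (le_bMax _ i).trans hB.bMax_le
    rw [hsq, hi] at h
    simp only [hx, ← add_assoc]
    exact h

end Converse

end SupportRecovery

end

theorem corollary3 (k : ℕ → ℕ) (σ : ℕ → ℝ) (b : (p : ℕ) → Fin (k p) → ℝ)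
    (hk : (fun p => (k p : ℝ)) =Θ[atTop] fun _ => (1 : ℝ))
    (hσpos : ∀ p, 0 < σ p)
    (hσ : (fun p => σ p ^ 2) =Θ[atTop] fun _ => (1 : ℝ))
    (hbpos : ∀ᶠ p in atTop, 0 < SupportRecovery.bMin (b p))
    (hb : (fun p => SupportRecovery.bMin (b p)) =Θ[atTop] fun p => SupportRecovery.bMax (b p))
    (hbo : (fun p => SupportRecovery.bMin (b p)) =o[atTop] fun _ => (1 : ℝ))
    (η : ℝ) (hη : 0 < η) (n : ℕ → ℕ) :
    -- 1-bit model
    ((∀ᶠ p in atTop,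
        SupportRecovery.oneBitThreshold p (σ p) (b p) * (1 + η) ≤ (n p : ℝ)) →
      ∃ dec : (p : ℕ) → SupportRecovery.Decoder p (n p),
        Tendsto (fun p => SupportRecovery.errorProb SupportRecovery.sgn (σ p) (b p) (dec p))
          atTop (𝓝 0)) ∧
    ((∀ᶠ p in atTop,
        (n p : ℝ) ≤ SupportRecovery.oneBitThreshold p (σ p) (b p) * (1 - η)) →
      ∀ dec : (p : ℕ) → SupportRecovery.Decoder p (n p),
        Tendsto (fun p => SupportRecovery.errorProb SupportRecovery.sgn (σ p) (b p) (dec p))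
          atTop (𝓝 1)) ∧
    -- linear model: the same with a threshold smaller by the factor `π / 2`
    ((∀ᶠ p in atTop,
        SupportRecovery.oneBitThreshold p (σ p) (b p) / (Real.pi / 2) * (1 + η) ≤ (n p : ℝ)) →
      ∃ dec : (p : ℕ) → SupportRecovery.Decoder p (n p),
        Tendsto (fun p => SupportRecovery.errorProb id (σ p) (b p) (dec p)) atTop (𝓝 0)) ∧
    ((∀ᶠ p in atTop,
        (n p : ℝ) ≤ SupportRecovery.oneBitThreshold p (σ p) (b p) / (Real.pi / 2) * (1 - η)) →
      ∀ dec : (p : ℕ) → SupportRecovery.Decoder p (n p),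
        Tendsto (fun p => SupportRecovery.errorProb id (σ p) (b p) (dec p)) atTop (𝓝 1)) := by
  obtain ⟨K, s₁, s₂, C, -, hs₁, hs₂, hC, hB⟩ :=
    SupportRecovery.exists_bounds k σ b hk hσpos hσ hbpos hb
  have hbo' := (isLittleO_one_iff ℝ).1 hbo
  refine ⟨SupportRecovery.tendsto_errorProb_sgn_zero hs₁ hB hbo' hη, fun hn => ?_,
    SupportRecovery.tendsto_errorProb_linear_zero hs₁ hB hbo' hη,
    SupportRecovery.tendsto_errorProb_linear_one hs₁ hB hbo' hη⟩
  -- The sign expansion needs ρ = η/4 to be at most 1. Lowering η only weakens the upper bound on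
  -- `n`, as the threshold is nonnegative.
  refine SupportRecovery.tendsto_errorProb_sgn_one hs₁ hs₂ hC hB hbo' (η := min η 1)
    (lt_min hη one_pos) (min_le_right η 1) ?_
  filter_upwards [hn, hB] with p hn hB
  have hL := Real.log_natCast_nonneg p
  have hpi := Real.pi_pos
  have hT : 0 ≤ SupportRecovery.oneBitThreshold p (σ p) (b p) := by
    rw [SupportRecovery.oneBitThreshold_eq hB.pos hB.sigma_pos _ hB.bMin_pos]
    positivity
  exact hn.trans (mul_le_mul_of_nonneg_left (by linarith [min_le_left η 1]) hT)
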